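/- Let $\alpha,\beta\in\mathbb{R}$, $\gamma\in\mathbb{C}$. For $\Psi\in H^2((0,\infty)\times\mathbb{R})\oplus H^2((-\infty,0)\times\mathbb{R})$ put $$\mathcal{H}\Psi=-\frac{\partial^2\Psi}{\partial x^2}+\frac12\Big(-\frac{\partial^2\Psi}{\partial y^2}+y^2\Psi\Big)\qquad (x\neq0),$$ and let $\mathbf{H}_{\alpha,\beta,\gamma}$ be the operator $\Psi\mapsto\mathcal H\Psi$ in $L^2(\mathbb{R}^2)$ whose domain consists of all such $\Psi$ with $\mathcal{H}\Psi\in L^2(\mathbb{R}^2)$ that satisfy, for almost every $y\in\mathbb{R}$ (boundary values in the sense of traces), $$\tfrac{\partial \Psi}{\partial x}(0+,y)-\tfrac{\partial \Psi}{\partial x}(0-,y)=\tfrac{\alpha}{2}y\big(\Psi(0+,y)+\Psi(0-,y)\big)+\tfrac{\gamma}{2}\big(\tfrac{\partial \Psi}{\partial x}(0+,y)+\tfrac{\partial \Psi}{\partial x}(0-,y)\big),$$ $$\Psi(0+,y)-\Psi(0-,y)=-\tfrac{\bar\gamma}{2}\big(\Psi(0+,y)+\Psi(0-,y)\big)+\tfrac{\beta}{2y}\big(\tfrac{\partial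 \Psi}{\partial x}(0+,y)+\tfrac{\partial \Psi}{\partial x}(0-,y)\big).$$ Let $$\mathbf{a}_0[\Psi]=\int_{\mathbb{R}^2}\Big(\big|\tfrac{\partial\Psi}{\partial x}\big|^2+\tfrac12\big|\tfrac{\partial\Psi}{\partial y}\big|^2+\tfrac12y^2|\Psi|^2\Big)\,dx\,dy,\qquad D=\{\Psi\in H^1((0,\infty)\times\mathbb{R})\oplus H^1((-\infty,0)\times\mathbb{R}):\ \mathbf{a}_0[\Psi]<\infty\},$$ where the derivatives are taken for $x\neq0$, and $$\mathbf{b}_1[\Psi]=\int_{\mathbb R}y\,|\Psi(0+,y)-\Psi(0-,y)|^2dy,\qquad \mathbf{b}_2[\Psi]=\int_{\mathbb R}\tfrac{\alpha\beta+|\gamma|^2}{4}\,y\,|\Psi(0+,y)+\Psi(0-,y)|^2dy,$$ $$\mathbf{b}_3[\Psi]=\int_{\mathbb R}y\,\mathrm{Re}\big[\gamma\,(\bar\Psi(0+,y)+\bar\Psi(0-,y))(\Psi(0+,y)-\Psi(0-,y))\big]dy,\qquad \mathbf{b}_4[\Psi]=\int_{\mathbb R}\tfrac{\alpha}{4}\,y\,|\Psi(0+,y)+\Psi(0-,y)|^2dy,$$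 $$\mathbf{a}_{\alpha,\beta,\gamma}[\Psi]=\mathbf{a}_0[\Psi]+\tfrac1\beta\big(\mathbf{b}_1[\Psi]+\mathbf{b}_2[\Psi]+\mathbf{b}_3[\Psi]\big)\ \ (\beta\neq0),\qquad \mathbf{a}_{\alpha,0,\gamma}[\Psi]=\mathbf{a}_0[\Psi]+\mathbf{b}_4[\Psi].$$ Then $\mathbf{H}_{\alpha,\beta,\gamma}$ is associated with the quadratic form $\mathbf{a}_{\alpha,\beta,\gamma}$ in the following sense. 1. For every $\Psi\in D$ the traces $\Psi(0\pm,y)$ exist for almost every $y$ (as essential limits as $x\to0\pm$), and the integrals defining $\mathbf{b}_1[\Psi],\dots,\mathbf{b}_4[\Psi]$ converge absolutely. 2. The domain of $\mathbf{H}_{\alpha,\beta,\gamma}$ is contained in $D$, and for every $\Psi$ in it $$\int_{\mathbb{R}^2}\overline{\Psi}\;\mathbf{H}_{\alpha,\beta,\gamma}\Psi\,dx\,dy=\mathbf{a}_{\alpha,\beta,\gamma}[\Psi].$$ 3. Let $\mathbf{a}_{\alpha,\beta,\gamma}(\Phi,\Psi)$ be the sesquilinear form (antilinear in $\Phi$)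 obtained from $\mathbf{a}_{\alpha,\beta,\gamma}[\cdot]$ by polarization. Let $D_{\beta,\gamma}=D$ if $\beta\neq0$, and if $\beta=0$ let $D_{0,\gamma}$ be the set of $\Psi\in D$ with $\Psi(0+,y)-\Psi(0-,y)=-\frac{\bar\gamma}2(\Psi(0+,y)+\Psi(0-,y))$ for almost every $y$. For all $\Psi\in H^2((0,\infty)\times\mathbb{R})\oplus H^2((-\infty,0)\times\mathbb{R})$ and $w\in L^2(\mathbb{R}^2)$, one has $\Psi\in\mathrm{dom}\,\mathbf{H}_{\alpha,\beta,\gamma}$ and $\mathbf{H}_{\alpha,\beta,\gamma}\Psi=w$ if and only if $\Psi\in D_{\beta,\gamma}$ and $$\mathbf{a}_{\alpha,\beta,\gamma}(\Phi,\Psi)=\int_{\mathbb{R}^2}\overline{\Phi}\,w\,dx\,dy\qquad\text{for all }\Phi\in D_{\beta,\gamma}.$$ -/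

import Mathlib

open MeasureTheory Filter Topology
open scoped ContDiff ComplexConjugate

noncomputable section

namespace Smilansky

/-- The open half-plane `(0,∞) × ℝ`. -/
def rightHalf : Set (ℝ × ℝ) := {p | 0 < p.1}

/-- The open half-plane `(-∞,0) × ℝ`. -/
def leftHalf : Set (ℝ × ℝ) := {p | p.1 < 0}

/-- The coordinate directions in the `(x,y)`-plane. -/
def ex : ℝ × ℝ := (1, 0)

/-- See `ex`. -/
def ey : ℝ × ℝ := (0, 1)

/-- `g` is the weak (distributional) derivative of `f` in the direction `v` on the open set `U`. -/
def IsWeakDeriv (U : Set (ℝ × ℝ)) (v : ℝ × ℝ) (f g : ℝ × ℝ → ℂ) : Prop :=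
  LocallyIntegrableOn f U volume ∧ LocallyIntegrableOn g U volume ∧
    ∀ φ : ℝ × ℝ → ℝ, ContDiff ℝ ∞ φ → HasCompactSupport φ → tsupport φ ⊆ U →
      ∫ p in U, (fderiv ℝ φ p v) • f p = - ∫ p in U, φ p • g p

open Classical in
/-- The weak derivative (a representative of it; unique up to null sets), `0` if there is none. -/
def weakDeriv (U : Set (ℝ × ℝ)) (v : ℝ × ℝ) (f : ℝ × ℝ → ℂ) : ℝ × ℝ → ℂ :=
  if h : ∃ g, IsWeakDeriv U v f g then h.choose else 0

/-- The Sobolev space `H¹(U)`. -/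
def MemH1 (U : Set (ℝ × ℝ)) (f : ℝ × ℝ → ℂ) : Prop :=
  MemLp f 2 (volume.restrict U) ∧
    (∃ g, IsWeakDeriv U ex f g ∧ MemLp g 2 (volume.restrict U)) ∧
    (∃ g, IsWeakDeriv U ey f g ∧ MemLp g 2 (volume.restrict U))

/-- `∂Ψ/∂x`, taken separately in the two half-planes (the line `x = 0` is a null set). -/
def dx (Ψ : ℝ × ℝ → ℂ) (p : ℝ × ℝ) : ℂ :=
  if 0 < p.1 then weakDeriv rightHalf ex Ψ p else weakDeriv leftHalf ex Ψ p

/-- `∂Ψ/∂y`, taken separately in the two half-planes. -/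
def dy (Ψ : ℝ × ℝ → ℂ) (p : ℝ × ℝ) : ℂ :=
  if 0 < p.1 then weakDeriv rightHalf ey Ψ p else weakDeriv leftHalf ey Ψ p

/-- `H¹((0,∞) × ℝ) ⊕ H¹((-∞,0) × ℝ)`. -/
def MemH1Sum (Ψ : ℝ × ℝ → ℂ) : Prop := MemH1 rightHalf Ψ ∧ MemH1 leftHalf Ψ

/-- `H²((0,∞) × ℝ) ⊕ H²((-∞,0) × ℝ)`. -/
def MemH2Sum (Ψ : ℝ × ℝ → ℂ) : Prop := MemH1Sum Ψ ∧ MemH1Sum (dx Ψ) ∧ MemH1Sum (dy Ψ)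

/-- `x → 0+` up to null sets of `x`: limits along this filter are essential one-sided limits. -/
def zeroPlus : Filter ℝ := ae volume ⊓ 𝓝[>] 0

/-- `x → 0-` up to null sets of `x`. -/
def zeroMinus : Filter ℝ := ae volume ⊓ 𝓝[<] 0

/-- The trace `Ψ(0+, y) = ess lim_{x → 0+} Ψ(x, y)`. -/
def trP (Ψ : ℝ × ℝ → ℂ) (y : ℝ) : ℂ := limUnder zeroPlus fun x => Ψ (x, y)

/-- The trace `Ψ(0-, y) = ess lim_{x → 0-} Ψ(x, y)`. -/
def trM (Ψ : ℝ × ℝ → ℂ) (y : ℝ) : ℂ := limUnder zeroMinus fun x => Ψ (x, y)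

/-- `Ψ(0+, y) + Ψ(0-, y)`. -/
def fSum (Ψ : ℝ × ℝ → ℂ) (y : ℝ) : ℂ := trP Ψ y + trM Ψ y

/-- `Ψ(0+, y) - Ψ(0-, y)`. -/
def fJump (Ψ : ℝ × ℝ → ℂ) (y : ℝ) : ℂ := trP Ψ y - trM Ψ y

/-- The differential expression `-∂²Ψ/∂x² + (1/2) (-∂²Ψ/∂y² + y² Ψ)` off the line `x = 0`. -/
def hamExpr (Ψ : ℝ × ℝ → ℂ) (p : ℝ × ℝ) : ℂ :=
  -(dx (dx Ψ) p) + (1 / 2) * (-(dy (dy Ψ) p) + (p.2 : ℂ) ^ 2 * Ψ p)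

/-- The first boundary condition: the jump of `∂Ψ/∂x` across `x = 0`. -/
def Coupling1 (α : ℝ) (γ : ℂ) (Ψ : ℝ × ℝ → ℂ) : Prop :=
  ∀ᵐ y : ℝ, fJump (dx Ψ) y = (α / 2 : ℂ) * y * fSum Ψ y + γ / 2 * fSum (dx Ψ) y

/-- The second boundary condition: the jump of `Ψ` across `x = 0`. -/
def Coupling2 (β : ℝ) (γ : ℂ) (Ψ : ℝ × ℝ → ℂ) : Prop :=
  ∀ᵐ y : ℝ, fJump Ψ y = -(conj γ / 2) * fSum Ψ y + (β / (2 * y) : ℂ) * fSum (dx Ψ) y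

/-- The domain of the operator `H_{α,β,γ}`, which acts there as `hamExpr`. -/
def domH (α β : ℝ) (γ : ℂ) : Set (ℝ × ℝ → ℂ) :=
  {Ψ | MemH2Sum Ψ ∧ MemLp (hamExpr Ψ) 2 volume ∧ Coupling1 α γ Ψ ∧ Coupling2 β γ Ψ}

/-- The integrand of `a₀[Ψ]`. -/
def a0Density (Ψ : ℝ × ℝ → ℂ) (p : ℝ × ℝ) : ℝ :=
  ‖dx Ψ p‖ ^ 2 + 1 / 2 * ‖dy Ψ p‖ ^ 2 + 1 / 2 * p.2 ^ 2 * ‖Ψ p‖ ^ 2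

/-- The form domain `D`: broken `H¹` functions with `a₀[Ψ] < ∞`. -/
def formDom : Set (ℝ × ℝ → ℂ) := {Ψ | MemH1Sum Ψ ∧ Integrable (a0Density Ψ) volume}

/-- The integrand of `b₁[Ψ]`. -/
def b1Density (Ψ : ℝ × ℝ → ℂ) (y : ℝ) : ℝ := y * ‖fJump Ψ y‖ ^ 2

/-- The integrand of `b₂[Ψ]`. -/
def b2Density (α β : ℝ) (γ : ℂ) (Ψ : ℝ × ℝ → ℂ) (y : ℝ) : ℝ :=
  (α * β + ‖γ‖ ^ 2) / 4 * y * ‖fSum Ψ y‖ ^ 2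

/-- The integrand of `b₃[Ψ]`. -/
def b3Density (γ : ℂ) (Ψ : ℝ × ℝ → ℂ) (y : ℝ) : ℝ :=
  y * (γ * conj (fSum Ψ y) * fJump Ψ y).re

/-- The integrand of `b₄[Ψ]`. -/
def b4Density (α : ℝ) (Ψ : ℝ × ℝ → ℂ) (y : ℝ) : ℝ := α / 4 * y * ‖fSum Ψ y‖ ^ 2

/-- The quadratic form `a₀`. -/
def a0 (Ψ : ℝ × ℝ → ℂ) : ℝ := ∫ p, a0Density Ψ p

/-- The quadratic form `b₁`. -/
def b1 (Ψ : ℝ × ℝ → ℂ) : ℝ := ∫ y, b1Density Ψ y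

/-- The quadratic form `b₂`. -/
def b2 (α β : ℝ) (γ : ℂ) (Ψ : ℝ × ℝ → ℂ) : ℝ := ∫ y, b2Density α β γ Ψ y

/-- The quadratic form `b₃`. -/
def b3 (γ : ℂ) (Ψ : ℝ × ℝ → ℂ) : ℝ := ∫ y, b3Density γ Ψ y

/-- The quadratic form `b₄`. -/
def b4 (α : ℝ) (Ψ : ℝ × ℝ → ℂ) : ℝ := ∫ y, b4Density α Ψ y

/-- The quadratic form `a_{α,β,γ}`. -/
def form (α β : ℝ) (γ : ℂ) (Ψ : ℝ × ℝ → ℂ) : ℝ :=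
  if β = 0 then a0 Ψ + b4 α Ψ else a0 Ψ + 1 / β * (b1 Ψ + b2 α β γ Ψ + b3 γ Ψ)

/-! The sesquilinear forms of which the above are the diagonals. -/

/-- The sesquilinear form of `a₀`. -/
def a0S (Φ Ψ : ℝ × ℝ → ℂ) : ℂ :=
  ∫ p, (conj (dx Φ p) * dx Ψ p + 1 / 2 * (conj (dy Φ p) * dy Ψ p)
    + 1 / 2 * (p.2 : ℂ) ^ 2 * (conj (Φ p) * Ψ p))

/-- The sesquilinear form of `b₁`. -/
def b1S (Φ Ψ : ℝ × ℝ → ℂ) : ℂ := ∫ y : ℝ, (y : ℂ) * (conj (fJump Φ y) * fJump Ψ y)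

/-- The sesquilinear form of `b₂`. -/
def b2S (α β : ℝ) (γ : ℂ) (Φ Ψ : ℝ × ℝ → ℂ) : ℂ :=
  ∫ y : ℝ, (((α * β + ‖γ‖ ^ 2) / 4 * y : ℝ) : ℂ) * (conj (fSum Φ y) * fSum Ψ y)

/-- The sesquilinear form of `b₃`. -/
def b3S (γ : ℂ) (Φ Ψ : ℝ × ℝ → ℂ) : ℂ :=
  ∫ y : ℝ, (y : ℂ) * (1 / 2) *
    (γ * conj (fSum Φ y) * fJump Ψ y + conj γ * conj (fJump Φ y) * fSum Ψ y)

/-- The sesquilinear form of `b₄`. -/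
def b4S (α : ℝ) (Φ Ψ : ℝ × ℝ → ℂ) : ℂ :=
  ∫ y : ℝ, ((α / 4 * y : ℝ) : ℂ) * (conj (fSum Φ y) * fSum Ψ y)

/-- The sesquilinear form of `a_{α,β,γ}`, antilinear in the first argument. -/
def formS (α β : ℝ) (γ : ℂ) (Φ Ψ : ℝ × ℝ → ℂ) : ℂ :=
  if β = 0 then a0S Φ Ψ + b4S α Φ Ψ
  else a0S Φ Ψ + 1 / (β : ℂ) * (b1S Φ Ψ + b2S α β γ Φ Ψ + b3S γ Φ Ψ)

/-- For `β ≠ 0` this is all of `D`. For `β = 0` the second boundary condition contains no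
derivative of `Ψ`, it reads `Ψ(0+,y) - Ψ(0-,y) = -(conj γ / 2) (Ψ(0+,y) + Ψ(0-,y))`, and it is
imposed on the elements of `D` (an essential boundary condition). -/
def essDom (β : ℝ) (γ : ℂ) : Set (ℝ × ℝ → ℂ) := {Ψ | Ψ ∈ formDom ∧ (β = 0 → Coupling2 0 γ Ψ)}

/-- The quadratic form is the diagonal of the sesquilinear one. -/
theorem formS_self (α β : ℝ) (γ : ℂ) (Ψ : ℝ × ℝ → ℂ) :
    formS α β γ Ψ Ψ = (form α β γ Ψ : ℂ) := by
  have hz : ∀ z : ℂ, conj z * z = ((‖z‖ ^ 2 : ℝ) : ℂ) := fun z => by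
    rw [mul_comm, Complex.mul_conj, Complex.normSq_eq_norm_sq]
  have h0 : a0S Ψ Ψ = (a0 Ψ : ℂ) := by
    rw [a0S, a0, ← integral_complex_ofReal]
    congr 1; ext p; rw [hz, hz, hz, a0Density]; push_cast; ring
  have h1 : b1S Ψ Ψ = (b1 Ψ : ℂ) := by
    rw [b1S, b1, ← integral_complex_ofReal]
    congr 1; ext y; rw [hz, b1Density]; push_cast; ring
  have h2 : b2S α β γ Ψ Ψ = (b2 α β γ Ψ : ℂ) := by
    rw [b2S, b2, ← integral_complex_ofReal]
    congr 1; ext y; rw [hz, b2Density]; push_cast; ring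
  have h3 : b3S γ Ψ Ψ = (b3 γ Ψ : ℂ) := by
    rw [b3S, b3, ← integral_complex_ofReal]
    congr 1; ext y; rw [b3Density]
    have := Complex.add_conj (γ * conj (fSum Ψ y) * fJump Ψ y)
    have e : conj (γ * conj (fSum Ψ y) * fJump Ψ y)
        = conj γ * conj (fJump Ψ y) * fSum Ψ y := by
      simp only [map_mul, Complex.conj_conj]; ring
    rw [e] at this; rw [this]; push_cast; ring
  have h4 : b4S α Ψ Ψ = (b4 α Ψ : ℂ) := by
    rw [b4S, b4, ← integral_complex_ofReal]
    congr 1; ext y; rw [hz, b4Density]; push_cast; ring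
  unfold formS form
  split_ifs
  · rw [h0, h4]; push_cast; ring
  · rw [h0, h1, h2, h3]; push_cast; ring

end Smilansky

end

noncomputable section

namespace Smilansky

/-! ### Primitives on the real line -/

/-! The argument is the weak formulation of a transmission problem. Write `S`, `J` for the sum and
jump of the traces of Φ, `s`, `j` for those of Ψ, and `s'`, `j'` for those of ∂Ψ/∂x. Integrating by
parts on both half-planes (`green_formula`) produces the boundary density (conj S · j' + conj J ·
s')/2. Hence a(Φ,Ψ) − ∫ conj Φ · ℋΨ is a single boundary integral, that of `formDensity` minus
`greenDensity` (`formS_eq_integral_add`).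

The coupling conditions make this integrand vanish pointwise (`formDensity_eq_greenDensity`), so the
operator represents the form. Conversely, test functions supported off the line x = 0 force w = ℋΨ
(`ae_eq_hamExpr`). The boundary integral then vanishes for every admissible Φ, and prescribing the
traces of Φ recovers the coupling conditions (`ae_densities_eq`): two independent choices of traces
if β ≠ 0, and for β = 0 the one direction allowed by the essential condition.

The analytic input is that an L² function with an L² weak derivative agrees, on almost every line,
with a primitive of that derivative (`ae_exists_primitive`). This gives traces and reduces Green's
formula to one dimension. The weighted boundary integrals converge because |Ψ(0±,y)|² is an
x-integral of terms Ψ · ∂Ψ/∂x, so a weight |y| costs only yΨ ∈ L² (`SobPair.integrable_weight_tr`).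
Finally dom H ⊆ D, because y²Ψ = 2ℋΨ + 2∂²Ψ/∂x² + ∂²Ψ/∂y² lies in L². -/

theorem absolutelyContinuous_primitive {g : ℝ → ℂ}
    (hg : ∀ a b, IntervalIntegrable g volume a b) (a b : ℝ) :
    AbsolutelyContinuousOnInterval (fun x => ∫ t in a..x, g t) a b := by
  have hre : ∀ u v, IntervalIntegrable (fun t => (g t).re) volume u v := fun u v =>
    ⟨(hg u v).1.re, (hg u v).2.re⟩
  have him : ∀ u v, IntervalIntegrable (fun t => (g t).im) volume u v := fun u v =>
    ⟨(hg u v).1.im, (hg u v).2.im⟩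
  have h1 := (hre a b).absolutelyContinuousOnInterval_intervalIntegral (c := a) (by simp)
  have h2 := (him a b).absolutelyContinuousOnInterval_intervalIntegral (c := a) (by simp)
  refine squeeze_zero (fun E => Finset.sum_nonneg fun i _ => dist_nonneg) (fun E => ?_)
    (by simpa using Tendsto.add h1 h2)
  rw [← Finset.sum_add_distrib]
  refine Finset.sum_le_sum fun i _ => ?_
  have e : ∀ x, (∫ t in a..x, g t) =
      ((∫ t in a..x, (g t).re : ℝ) : ℂ) + ((∫ t in a..x, (g t).im : ℝ) : ℂ) * Complex.I := by
    intro x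
    rw [← intervalIntegral.integral_ofReal, ← intervalIntegral.integral_ofReal,
      ← intervalIntegral.integral_mul_const, ← intervalIntegral.integral_add]
    · simp only [Complex.re_add_im]
    · exact ⟨(hre a x).1.ofReal, (hre a x).2.ofReal⟩
    · exact IntervalIntegrable.mul_const ⟨(him a x).1.ofReal, (him a x).2.ofReal⟩ _
  simp only [e]
  rw [dist_eq_norm, Real.dist_eq, Real.dist_eq]
  set p := ∫ t in a..(E.2 i).1, (g t).re
  set q := ∫ t in a..(E.2 i).1, (g t).im
  set r := ∫ t in a..(E.2 i).2, (g t).re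
  set s := ∫ t in a..(E.2 i).2, (g t).im
  refine (Complex.norm_le_abs_re_add_abs_im _).trans (le_of_eq ?_)
  simp

/-- Product rule for absolutely continuous functions: the difference of the product and the
primitive of its formal derivative is absolutely continuous with derivative zero almost everywhere,
hence constant. -/
theorem primitive_mul_primitive {g v : ℝ → ℂ} (hg : ∀ a b, IntervalIntegrable g volume a b)
    (hv : ∀ a b, IntervalIntegrable v volume a b) (c d : ℂ) (b : ℝ) :
    (c + ∫ t in 0..b, g t) * (d + ∫ t in 0..b, v t) = c * d +
      ∫ x in 0..b, (g x * (d + ∫ t in 0..x, v t) + (c + ∫ t in 0..x, g t) * v x) := by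
  set F : ℝ → ℂ := fun x => c + ∫ t in 0..x, g t with hF
  set U : ℝ → ℂ := fun x => d + ∫ t in 0..x, v t with hU
  have cF : Continuous F := continuous_const.add (intervalIntegral.continuous_primitive hg 0)
  have cU : Continuous U := continuous_const.add (intervalIntegral.continuous_primitive hv 0)
  have hconst : ∀ z : ℂ, AbsolutelyContinuousOnInterval (fun _ : ℝ => z) 0 b := fun z =>
    ContDiffOn.absolutelyContinuousOnInterval contDiffOn_const
  have aF : AbsolutelyContinuousOnInterval F 0 b :=
    (hconst c).add (absolutelyContinuous_primitive hg 0 b)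
  have aU : AbsolutelyContinuousOnInterval U 0 b :=
    (hconst d).add (absolutelyContinuous_primitive hv 0 b)
  set k : ℝ → ℂ := fun x => g x * U x + F x * v x with hk
  have ik : ∀ a b, IntervalIntegrable k volume a b := fun a b =>
    ((hg a b).mul_continuousOn cU.continuousOn).add ((hv a b).continuousOn_mul cF.continuousOn)
  have aK := absolutelyContinuous_primitive ik 0 b
  have aD := (aF.smul aU).sub aK
  obtain ⟨C, hC⟩ := aD.const_of_ae_hasDerivAt_zero (by
    filter_upwards [(hg 0 b).ae_hasDerivAt_integral, (hv 0 b).ae_hasDerivAt_integral,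
      (ik 0 b).ae_hasDerivAt_integral] with x h1 h2 h3 hx
    have e1 : HasDerivAt F (g x) x := (h1 hx 0 (by simp)).const_add c
    have e2 : HasDerivAt U (v x) x := (h2 hx 0 (by simp)).const_add d
    have e3 := h3 hx 0 (by simp)
    convert! (e1.mul e2).sub e3 using 1
    simp [hk])
  have h0 := hC 0 (by simp)
  have h1 := hC b (by simp)
  simp only [Pi.sub_apply, smul_eq_mul, Pi.mul_apply, intervalIntegral.integral_same,
    sub_zero] at h0 h1
  have : F 0 * U 0 = c * d := by simp [hF, hU]
  rw [← h0, this] at h1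
  change F b * U b = c * d + ∫ x in 0..b, k x
  rw [← h1]; ring

/-- On `(0,∞)`, `F` coincides almost everywhere with the primitive of `G` with value `c` at `0`. -/
def HasPrim (F G : ℝ → ℂ) (c : ℂ) : Prop :=
  ∀ᵐ x : ℝ, 0 < x → F x = c + ∫ t in 0..x, G t

theorem intervalIntegrable_indicator {G : ℝ → ℂ} {s : Set ℝ} (hs : MeasurableSet s)
    (hG : MemLp G 2 (volume.restrict s)) (a b : ℝ) :
    IntervalIntegrable (s.indicator G) volume a b := by
  have h : LocallyIntegrable (s.indicator G) volume :=
    ((memLp_indicator_iff_restrict hs).2 hG).locallyIntegrable (by norm_num)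
  exact (h.integrableOn_isCompact isCompact_uIcc).intervalIntegrable

theorem integral_indicator_Ioi (G : ℝ → ℂ) {x : ℝ} (hx : 0 ≤ x) :
    ∫ t in 0..x, (Set.Ioi (0 : ℝ)).indicator G t = ∫ t in 0..x, G t := by
  refine intervalIntegral.integral_congr_ae (ae_of_all _ fun t ht => ?_)
  rw [Set.uIoc_of_le hx] at ht
  simp [ht.1]

/-- The primitive is continuous at 0, and a limit along `zeroPlus` ignores the null set on which `F`
differs from it. Thus `c` is the trace of `F`. -/
theorem HasPrim.tendsto {F G : ℝ → ℂ} {c : ℂ} (h : HasPrim F G c)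
    (hG : MemLp G 2 (volume.restrict (Set.Ioi 0))) : Tendsto F zeroPlus (𝓝 c) := by
  have hc := intervalIntegral.continuous_primitive
    (intervalIntegrable_indicator measurableSet_Ioi hG) 0
  have h0 : Tendsto (fun x => c + ∫ t in 0..x, (Set.Ioi (0 : ℝ)).indicator G t) zeroPlus
      (𝓝 c) := by
    have := (hc.tendsto 0).const_add c
    simp only [intervalIntegral.integral_same, add_zero] at this
    exact this.mono_left (inf_le_right.trans nhdsWithin_le_nhds)
  refine h0.congr' ?_
  have h1 : ∀ᶠ x in zeroPlus, 0 < x := by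
    have : ∀ᶠ x in 𝓝[>] (0 : ℝ), 0 < x := eventually_mem_nhdsWithin
    exact this.filter_mono inf_le_right
  have h2 : ∀ᶠ x in zeroPlus, 0 < x → F x = c + ∫ t in 0..x, G t := h.filter_mono inf_le_left
  filter_upwards [h1, h2] with x hx e
  rw [e hx, integral_indicator_Ioi G hx.le]

/-- Integration by parts on the half-line. The only boundary term is at 0, because the product of
the primitives vanishes at infinity. -/
theorem HasPrim.integral_mul {F G U V : ℝ → ℂ} {c d : ℂ} (hFG : HasPrim F G c)
    (hUV : HasPrim U V d)
    (hF : MemLp F 2 (volume.restrict (Set.Ioi 0))) (hG : MemLp G 2 (volume.restrict (Set.Ioi 0)))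
    (hU : MemLp U 2 (volume.restrict (Set.Ioi 0)))
    (hV : MemLp V 2 (volume.restrict (Set.Ioi 0))) :
    ∫ x in Set.Ioi 0, (F x * V x + G x * U x) = -(c * d) := by
  set G' := (Set.Ioi (0 : ℝ)).indicator G
  set V' := (Set.Ioi (0 : ℝ)).indicator V
  have iG := intervalIntegrable_indicator measurableSet_Ioi hG
  have iV := intervalIntegrable_indicator measurableSet_Ioi hV
  set P : ℝ → ℂ := fun b => (c + ∫ t in 0..b, G' t) * (d + ∫ t in 0..b, V' t)
  have hP : ∀ b, P b = c * d + ∫ x in 0..b,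
      (G' x * (d + ∫ t in 0..x, V' t) + (c + ∫ t in 0..x, G' t) * V' x) :=
    primitive_mul_primitive iG iV c d
  have eF : ∀ᵐ x ∂volume.restrict (Set.Ioi (0 : ℝ)), F x = c + ∫ t in 0..x, G' t := by
    filter_upwards [ae_restrict_of_ae hFG, ae_restrict_mem measurableSet_Ioi] with x h hx
    rw [h hx, integral_indicator_Ioi G (le_of_lt hx)]
  have eU : ∀ᵐ x ∂volume.restrict (Set.Ioi (0 : ℝ)), U x = d + ∫ t in 0..x, V' t := by
    filter_upwards [ae_restrict_of_ae hUV, ae_restrict_mem measurableSet_Ioi] with x h hx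
    rw [h hx, integral_indicator_Ioi V (le_of_lt hx)]
  have iK : IntegrableOn (fun x => F x * V x + G x * U x) (Set.Ioi 0) :=
    (hF.integrable_mul hV).add (hG.integrable_mul hU)
  have iFU : IntegrableOn (fun x => F x * U x) (Set.Ioi 0) := hF.integrable_mul hU
  have iP : IntegrableOn P (Set.Ioi 0) := by
    refine iFU.congr ?_
    filter_upwards [eF, eU] with x h1 h2
    simp only [P, h1, h2]
  have lim := intervalIntegral_tendsto_integral_Ioi 0 iK tendsto_id
  have lim2 : Tendsto P atTop (𝓝 (c * d + ∫ x in Set.Ioi 0, (F x * V x + G x * U x))) := by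
    refine (lim.const_add (c * d)).congr' ?_
    filter_upwards [eventually_ge_atTop 0] with b hb
    rw [hP]
    congr 1
    refine intervalIntegral.integral_congr_ae ?_
    rw [← ae_restrict_iff' measurableSet_uIoc]
    have hsub : Set.uIoc 0 (id b) ⊆ Set.Ioi (0 : ℝ) := by
      simp only [id, Set.uIoc_of_le hb]; exact Set.Ioc_subset_Ioi_self
    filter_upwards [ae_mono (Measure.restrict_mono_set _ hsub) eF,
      ae_mono (Measure.restrict_mono_set _ hsub) eU, ae_restrict_mem measurableSet_uIoc]
      with x h1 h2 hx
    have hx' : x ∈ Set.Ioi (0 : ℝ) := hsub hx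
    rw [← h1, ← h2]
    simp only [G', V', Set.indicator_of_mem hx']
    ring
  -- `P` has a limit at infinity and is integrable, being almost everywhere `F * U`; since every
  -- neighbourhood of infinity has infinite measure, the limit is 0.
  have hz := IntegrableAtFilter.eq_zero_of_tendsto (μ := volume)
    ⟨Set.Ioi 0, Ioi_mem_atTop 0, iP⟩ (fun s hs => by
      rcases mem_atTop_sets.1 hs with ⟨b, hb⟩
      rw [← top_le_iff, ← Real.volume_Ici (a := b)]
      exact measure_mono hb) lim2
  linear_combination hz

theorem memLp_comp_neg_Ioi {F : ℝ → ℂ} (hF : MemLp F 2 volume) :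
    MemLp (fun x => F (-x)) 2 (volume.restrict (Set.Ioi 0)) :=
  ((hF.comp_measurePreserving (Measure.measurePreserving_neg volume)).restrict _)

/-- The half-line formula is applied to the functions and to their reflections; the two boundary
terms at 0 cancel. -/
theorem integral_mul_eq_zero_of_primitive {F G U V : ℝ → ℂ} {c d : ℂ}
    (hFG : ∀ᵐ x, F x = c + ∫ t in 0..x, G t) (hUV : ∀ᵐ x, U x = d + ∫ t in 0..x, V t)
    (hF : MemLp F 2 volume) (hG : MemLp G 2 volume) (hU : MemLp U 2 volume)
    (hV : MemLp V 2 volume) : ∫ x, (F x * V x + G x * U x) = 0 := by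
  have iK : Integrable (fun x => F x * V x + G x * U x) :=
    (hF.integrable_mul hV).add (hG.integrable_mul hU)
  have h1 := HasPrim.integral_mul (hFG.mono fun x h _ => h) (hUV.mono fun x h _ => h)
    (hF.restrict _) (hG.restrict _) (hU.restrict _) (hV.restrict _)
  have refl : ∀ {F G : ℝ → ℂ} {c : ℂ}, (∀ᵐ x, F x = c + ∫ t in 0..x, G t) →
      HasPrim (fun x => F (-x)) (fun x => -G (-x)) c := by
    intro F G c h
    filter_upwards [(Measure.measurePreserving_neg (volume : Measure ℝ)).quasiMeasurePreserving.ae h]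
      with x hx _
    rw [hx, intervalIntegral.integral_neg, intervalIntegral.integral_comp_neg, neg_zero,
      ← intervalIntegral.integral_symm]
  have h2 := HasPrim.integral_mul (refl hFG) (refl hUV) (memLp_comp_neg_Ioi hF)
    (memLp_comp_neg_Ioi hG).neg (memLp_comp_neg_Ioi hU) (memLp_comp_neg_Ioi hV).neg
  have h3 : ∫ x in Set.Iic 0, (F x * V x + G x * U x) = c * d := by
    have := integral_comp_neg_Ioi (0 : ℝ) (fun x => F x * V x + G x * U x)
    rw [neg_zero] at this
    rw [← this, ← neg_neg (c * d), ← h2, ← integral_neg]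
    congr 1; ext x; ring
  rw [← intervalIntegral.integral_Iic_add_Ioi iK.integrableOn iK.integrableOn (b := 0), h1, h3]
  ring

/-- Two good points `a`, `a₀` are compared through a common `b` to the right of both. If there is no
good point at all, `I` is null and any constant serves. -/
theorem exists_const_of_ae_ae_eq {I : Set ℝ} {k : ℝ → ℂ}
    (h : ∀ᵐ a : ℝ, a ∈ I → ∀ᵐ b : ℝ, a < b → k b = k a) :
    ∃ c, ∀ᵐ a : ℝ, a ∈ I → k a = c := by
  by_cases hA : ∃ a, ∀ᵐ b : ℝ, a < b → k b = k a
  · obtain ⟨a₀, ha₀⟩ := hA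
    refine ⟨k a₀, ?_⟩
    filter_upwards [h] with a ha haI
    have hpos : volume (Set.Ioi (max a a₀)) ≠ 0 := by simp
    have : ∃ᵐ b : ℝ, b ∈ Set.Ioi (max a a₀) := frequently_ae_mem_iff.2 hpos
    obtain ⟨b, hb, h1, h2⟩ := (this.and_eventually ((ha haI).and ha₀)).exists
    rw [← h1 (lt_of_le_of_lt (le_max_left _ _) hb), h2 (lt_of_le_of_lt (le_max_right _ _) hb)]
  · refine ⟨0, ?_⟩
    filter_upwards [h] with a ha haI
    exact absurd (ha haI) (fun h' => hA ⟨a, h'⟩)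

/-- Makes essential limits unique, so that `limUnder` returns the limit whenever one exists. -/
instance zeroPlus_neBot : zeroPlus.NeBot := by
  rw [zeroPlus, inf_neBot_iff]
  intro s hs t ht
  obtain ⟨e, he, hsub⟩ := mem_nhdsGT_iff_exists_Ioo_subset.1 ht
  have hpos : volume (Set.Ioo 0 e) ≠ 0 := by simpa using he
  have : ∃ᵐ b : ℝ, b ∈ Set.Ioo 0 e := frequently_ae_mem_iff.2 hpos
  obtain ⟨b, hb, hbs⟩ := (this.and_eventually hs).exists
  exact ⟨b, hbs, hsub hb⟩

/-! ### Weak derivatives and translations -/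

theorem measurePreserving_shear (v : ℝ × ℝ) (μ : Measure ℝ) [SFinite μ] :
    MeasurePreserving (fun z : ℝ × (ℝ × ℝ) => (z.1, z.2 + z.1 • v))
      (μ.prod volume) (μ.prod volume) := by
  refine MeasurePreserving.skew_product (MeasurePreserving.id μ)
    (g := fun (s : ℝ) (p : ℝ × ℝ) => p + s • v) ?_ (ae_of_all _ fun s => ?_)
  · exact (by fun_prop : Continuous fun z : ℝ × (ℝ × ℝ) => z.2 + z.1 • v).measurable
  · exact map_add_right_eq_self volume (s • v)

/-- The translates of `K` by `s • v`, 0 ≤ s ≤ h, sweep out a compact set `K'`, so the integrand is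
dominated by a constant times |H| on `K'`, uniformly in s. This justifies the exchanges of integrals
below. -/
theorem integrable_smul_translate {H : ℝ × ℝ → ℂ} (hH : LocallyIntegrable H volume)
    {φ : ℝ × ℝ → ℝ} (hφ : Measurable φ) {C : ℝ} (hC : ∀ p, ‖φ p‖ ≤ C) {K : Set (ℝ × ℝ)}
    (hK : IsCompact K) (hφK : ∀ p ∉ K, φ p = 0) (v : ℝ × ℝ) (h : ℝ) :
    Integrable (fun z : ℝ × (ℝ × ℝ) => φ (z.2 - z.1 • v) • H z.2)
      ((volume.restrict (Set.Ioc 0 h)).prod volume) := by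
  set K' : Set (ℝ × ℝ) := (fun z : ℝ × (ℝ × ℝ) => z.2 + z.1 • v) '' (Set.Icc 0 h ×ˢ K)
  have hK' : IsCompact K' := (isCompact_Icc.prod hK).image (by fun_prop)
  have iH : Integrable (K'.indicator H) :=
    (integrable_indicator_iff hK'.measurableSet).2 (hH.integrableOn_isCompact hK')
  have i1 : Integrable (fun _ : ℝ => (1 : ℝ)) (volume.restrict (Set.Ioc 0 h)) :=
    integrable_const _
  refine (i1.mul_prod (iH.norm.const_mul C)).mono' ?_ ?_
  · have hHm : AEStronglyMeasurable H volume := hH.aestronglyMeasurable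
    have hm : Measurable fun z : ℝ × (ℝ × ℝ) => z.2 - z.1 • v :=
      (by fun_prop : Continuous fun z : ℝ × (ℝ × ℝ) => z.2 - z.1 • v).measurable
    exact (hφ.comp hm).aestronglyMeasurable.smul hHm.comp_snd
  · filter_upwards [Measure.quasiMeasurePreserving_fst.ae
      (ae_restrict_mem (measurableSet_Ioc (a := (0 : ℝ)) (b := h)))] with z hz
    rw [norm_smul, one_mul]
    by_cases hzK : z.2 ∈ K'
    · rw [Set.indicator_of_mem hzK]
      exact mul_le_mul_of_nonneg_right (hC _) (norm_nonneg _)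
    · rw [hφK, norm_zero, zero_mul, Set.indicator_of_notMem hzK, norm_zero, mul_zero]
      exact fun hmem => hzK ⟨(z.1, z.2 - z.1 • v), ⟨⟨hz.1.le, hz.2⟩, hmem⟩, by simp⟩

theorem integrable_smul_comp_shear {H : ℝ × ℝ → ℂ} (hH : LocallyIntegrable H volume)
    {φ : ℝ × ℝ → ℝ} (hφ : Measurable φ) {C : ℝ} (hC : ∀ p, ‖φ p‖ ≤ C) {K : Set (ℝ × ℝ)}
    (hK : IsCompact K) (hφK : ∀ p ∉ K, φ p = 0) (v : ℝ × ℝ) (h : ℝ) :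
    Integrable (fun z : ℝ × (ℝ × ℝ) => φ z.2 • H (z.2 + z.1 • v))
      ((volume.restrict (Set.Ioc 0 h)).prod volume) := by
  have := (measurePreserving_shear v (volume.restrict (Set.Ioc 0 h))).integrable_comp_of_integrable
    (integrable_smul_translate hH hφ hC hK hφK v h)
  simpa [Function.comp_def] using this

theorem locallyIntegrable_integral_translate {H : ℝ × ℝ → ℂ} (hH : LocallyIntegrable H volume)
    (v : ℝ × ℝ) {h : ℝ} (hh : 0 ≤ h) :
    LocallyIntegrable (fun p => ∫ s in 0..h, H (p + s • v)) volume := by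
  rw [locallyIntegrable_iff]
  intro K hK
  have hb : ∀ p : ℝ × ℝ, ‖K.indicator (fun _ => (1 : ℝ)) p‖ ≤ 1 := fun p => by
    by_cases hp : p ∈ K <;> simp [hp]
  have := (integrable_smul_comp_shear hH (measurable_const.indicator hK.measurableSet) hb hK
    (fun p hp => Set.indicator_of_notMem hp _) v h).integral_prod_right
  rw [← integrable_indicator_iff hK.measurableSet]
  refine this.congr (ae_of_all _ fun p => ?_)
  by_cases hp : p ∈ K
  · simp [hp, intervalIntegral.integral_of_le hh]
  · simp [hp]

/-- The weak identity is tested with φ(· − s v) and integrated over s ∈ [0, h]. Forward invariance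
of `U` keeps the supports of the translated test functions inside `U`. -/
theorem integral_smul_translate_sub {U : Set (ℝ × ℝ)} {v : ℝ × ℝ}
    (hinv : ∀ p ∈ U, ∀ s : ℝ, 0 ≤ s → p + s • v ∈ U) {f g : ℝ × ℝ → ℂ}
    (hf : LocallyIntegrable f volume) (hg : LocallyIntegrable g volume)
    (hw : ∀ φ : ℝ × ℝ → ℝ, ContDiff ℝ ∞ φ → HasCompactSupport φ → tsupport φ ⊆ U →
      ∫ p, (fderiv ℝ φ p v) • f p = - ∫ p, φ p • g p)
    {φ : ℝ × ℝ → ℝ} (hφ : ContDiff ℝ ∞ φ) (hφc : HasCompactSupport φ) (hφU : tsupport φ ⊆ U)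
    {h : ℝ} (hh : 0 ≤ h) :
    ∫ p, (φ (p - h • v) - φ p) • f p = ∫ p, φ p • ∫ s in 0..h, g (p + s • v) := by
  have hd : Differentiable ℝ φ := hφ.differentiable (by simp)
  have hcd : Continuous fun p => fderiv ℝ φ p v :=
    (hφ.continuous_fderiv (by simp)).clm_apply continuous_const
  have hcs : HasCompactSupport fun p => fderiv ℝ φ p v := hφc.fderiv_apply ℝ v
  obtain ⟨C, hC⟩ := hcd.bounded_above_of_compact_support hcs
  obtain ⟨C', hC'⟩ := hφ.continuous.bounded_above_of_compact_support hφc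
  have i1 := integrable_smul_translate hf hcd.measurable hC hcs
    (fun p hp => image_eq_zero_of_notMem_tsupport (f := fun p => fderiv ℝ φ p v) hp) v h
  have i2 := integrable_smul_comp_shear hg hφ.continuous.measurable hC' hφc
    (fun p hp => image_eq_zero_of_notMem_tsupport hp) v h
  have ftc : ∀ p, φ (p - h • v) - φ p = ∫ s in 0..h, -(fderiv ℝ φ (p - s • v) v) := by
    intro p
    have hder : ∀ s : ℝ, HasDerivAt (fun s : ℝ => φ (p - s • v)) (-(fderiv ℝ φ (p - s • v) v)) s := by
      intro s
      have e1 : HasDerivAt (fun s : ℝ => p - s • v) (-v) s := by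
        simpa using ((hasDerivAt_id s).smul_const v).const_sub p
      have e2 := (hd (p - s • v)).hasFDerivAt.comp_hasDerivAt s e1
      rw [map_neg] at e2
      exact e2
    rw [intervalIntegral.integral_eq_sub_of_hasDerivAt (fun s _ => hder s)]
    · simp
    · exact (hcd.comp (by fun_prop)).neg.intervalIntegrable _ _
  calc ∫ p, (φ (p - h • v) - φ p) • f p
      = ∫ p, ∫ s in Set.Ioc 0 h, -((fderiv ℝ φ (p - s • v) v) • f p) := by
        congr 1; ext p
        rw [ftc, intervalIntegral.integral_of_le hh, ← integral_smul_const]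
        simp only [neg_smul]
    _ = ∫ s in Set.Ioc 0 h, ∫ p, -((fderiv ℝ φ (p - s • v) v) • f p) :=
        (integral_integral_swap i1.neg).symm
    _ = ∫ s in Set.Ioc 0 h, ∫ p, φ p • g (p + s • v) := by
        refine setIntegral_congr_fun measurableSet_Ioc fun s hs => ?_
        have hs0 : 0 ≤ s := hs.1.le
        have hts : tsupport (fun p => φ (p - s • v)) ⊆ U := by
          have h1 := tsupport_comp_subset_preimage φ
            (f := fun p : ℝ × ℝ => p - s • v) (by fun_prop)
          intro p hp
          have := hinv _ (hφU (h1 hp)) s hs0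
          simpa using this
        have hcs' : HasCompactSupport fun p => φ (p - s • v) :=
          hφc.comp_homeomorph (Homeomorph.subRight (s • v))
        have := hw (fun p => φ (p - s • v)) (hφ.comp (by fun_prop)) hcs' hts
        simp only [fderiv_comp_sub] at this
        rw [integral_neg, this, neg_neg,
          ← integral_add_right_eq_self (fun p => φ (p - s • v) • g p) (s • v)]
        simp
    _ = ∫ p, ∫ s in Set.Ioc 0 h, φ p • g (p + s • v) := integral_integral_swap i2
    _ = _ := by
        congr 1; ext p
        rw [integral_smul, intervalIntegral.integral_of_le hh]

/-- Fundamental theorem of calculus for weak derivatives: the preceding identity holds against all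
test functions on `U`, hence almost everywhere on `U`. -/
theorem ae_eq_add_integral_translate {U : Set (ℝ × ℝ)} (hU : IsOpen U) {v : ℝ × ℝ}
    (hinv : ∀ p ∈ U, ∀ s : ℝ, 0 ≤ s → p + s • v ∈ U) {f g : ℝ × ℝ → ℂ}
    (hf : LocallyIntegrable f volume) (hg : LocallyIntegrable g volume)
    (hw : ∀ φ : ℝ × ℝ → ℝ, ContDiff ℝ ∞ φ → HasCompactSupport φ → tsupport φ ⊆ U →
      ∫ p, (fderiv ℝ φ p v) • f p = - ∫ p, φ p • g p) {h : ℝ} (hh : 0 ≤ h) :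
    ∀ᵐ p, p ∈ U → f (p + h • v) = f p + ∫ s in 0..h, g (p + s • v) := by
  have lf : LocallyIntegrable (fun p => f (p + h • v)) volume := by
    rw [locallyIntegrable_iff]
    intro K hK
    have hK' : IsCompact ((fun p => p + h • v) '' K) := hK.image (by fun_prop)
    exact (((measurePreserving_add_right volume (h • v)).integrableOn_image
      (MeasurableEquiv.addRight (h • v)).measurableEmbedding).1
      (hf.integrableOn_isCompact hK'))
  have lg := locallyIntegrable_integral_translate hg v hh
  have key := hU.ae_eq_zero_of_integral_contDiff_smul_eq_zero (μ := volume)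
    (f := fun p => f (p + h • v) - f p - ∫ s in 0..h, g (p + s • v))
    (((lf.sub hf).sub lg).locallyIntegrableOn U) (by
      intro φ hφ hφc hφU
      have j1 := lf.integrable_smul_left_of_hasCompactSupport hφ.continuous hφc
      have j2 := hf.integrable_smul_left_of_hasCompactSupport hφ.continuous hφc
      have j3 := lg.integrable_smul_left_of_hasCompactSupport hφ.continuous hφc
      have hφc' : HasCompactSupport fun p => φ (p - h • v) :=
        hφc.comp_homeomorph (Homeomorph.subRight (h • v))
      have j4 := hf.integrable_smul_left_of_hasCompactSupport
        (hφ.continuous.comp (by fun_prop : Continuous fun p : ℝ × ℝ => p - h • v)) hφc'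
      have := integral_smul_translate_sub hinv hf hg hw hφ hφc hφU hh
      simp only [smul_sub]
      have e1 : ∫ x, (φ x • f (x + h • v) - φ x • f x - φ x • ∫ s in 0..h, g (x + s • v)) =
          (∫ x, (φ x • f (x + h • v) - φ x • f x)) - ∫ x, φ x • ∫ s in 0..h, g (x + s • v) :=
        integral_sub (j1.sub j2) j3
      rw [e1, integral_sub j1 j2, ← this]
      simp only [sub_smul]
      have e2 : ∫ x, (φ (x - h • v) • f x - φ x • f x) =
          (∫ x, φ (x - h • v) • f x) - ∫ x, φ x • f x := integral_sub j4 j2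
      rw [e2,
        ← integral_add_right_eq_self (fun p => φ (p - h • v) • f p) (h • v)]
      simp)
  filter_upwards [key] with p hp hpU
  linear_combination hp hpU

/-! ### Restriction of Sobolev functions to lines -/

/-- The defining identity of the weak derivative, for functions on the whole plane. -/
def WeakDerivOn (U : Set (ℝ × ℝ)) (v : ℝ × ℝ) (f g : ℝ × ℝ → ℂ) : Prop :=
  ∀ φ : ℝ × ℝ → ℝ, ContDiff ℝ ∞ φ → HasCompactSupport φ → tsupport φ ⊆ U →
    ∫ p, (fderiv ℝ φ p v) • f p = - ∫ p, φ p • g p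

/-- Extension by zero makes the translation argument, which needs functions on the whole plane,
available on `U`. -/
theorem IsWeakDeriv.weakDerivOn_indicator {U : Set (ℝ × ℝ)} (hU : MeasurableSet U) {v : ℝ × ℝ}
    {f g : ℝ × ℝ → ℂ} (h : IsWeakDeriv U v f g) :
    WeakDerivOn U v (U.indicator f) (U.indicator g) := by
  intro φ h1 h2 h3
  have := h.2.2 φ h1 h2 h3
  rw [← integral_indicator hU, ← integral_indicator hU] at this
  simpa only [Set.indicator_smul] using this

theorem WeakDerivOn.comp_equiv {U : Set (ℝ × ℝ)} {v : ℝ × ℝ} {f g : ℝ × ℝ → ℂ}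
    (h : WeakDerivOn U v f g) (T : (ℝ × ℝ) ≃L[ℝ] (ℝ × ℝ))
    (hT : MeasurePreserving T volume volume) :
    WeakDerivOn (T ⁻¹' U) (T.symm v) (f ∘ T) (g ∘ T) := by
  intro φ h1 h2 h3
  have hemb : MeasurableEmbedding T := T.toHomeomorph.measurableEmbedding
  have hts : tsupport (φ ∘ T.symm) = T.symm ⁻¹' tsupport φ :=
    tsupport_comp_eq_preimage φ T.symm.toHomeomorph
  have := h (φ ∘ T.symm) (h1.comp T.symm.contDiff) (h2.comp_homeomorph T.symm.toHomeomorph) (by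
    rw [hts]; intro p hp; simpa using h3 hp)
  rw [← hT.integral_comp hemb, ← hT.integral_comp hemb (fun p => (φ ∘ T.symm) p • g p)] at this
  have e : ∀ q, fderiv ℝ (φ ∘ T.symm) (T q) v = fderiv ℝ φ q (T.symm v) := by
    intro q
    rw [T.symm.comp_right_fderiv]
    simp
  simpa [e] using this

theorem ae_ae_slice {P : ℝ × ℝ → Prop} (h : ∀ᵐ p, P p) : ∀ᵐ y : ℝ, ∀ᵐ x : ℝ, P (x, y) :=
  Measure.ae_ae_of_ae_prod
    ((Measure.measurePreserving_swap (μ := volume) (ν := volume)).quasiMeasurePreserving.ae h)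

theorem memLp_slice {f : ℝ × ℝ → ℂ} (hf : MemLp f 2 volume) :
    ∀ᵐ y : ℝ, MemLp (fun x => f (x, y)) 2 volume := by
  have h1 := ((memLp_two_iff_integrable_sq_norm hf.1).1 hf).prod_left_ae
  filter_upwards [h1, ae_ae_slice hf.1.ae_eq_mk] with y hy hm
  have hs : AEStronglyMeasurable (fun x => f (x, y)) volume :=
    ⟨fun x => hf.1.mk f (x, y), hf.1.stronglyMeasurable_mk.comp_measurable (by fun_prop), hm⟩
  exact (memLp_two_iff_integrable_sq_norm hs).2 hy

theorem intervalIntegrable_of_memLp {G : ℝ → ℂ} (hG : MemLp G 2 volume) (a b : ℝ) :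
    IntervalIntegrable G volume a b :=
  ((hG.locallyIntegrable (by norm_num)).integrableOn_isCompact isCompact_uIcc).intervalIntegrable

/-- Joint measurability in the step length and the base point is what allows the quantifiers "for
every h, for almost every p" to be exchanged by Fubini. -/
theorem stronglyMeasurable_translate_integral {g : ℝ × ℝ → ℂ} (hg : StronglyMeasurable g)
    (v : ℝ × ℝ) : StronglyMeasurable fun z : ℝ × (ℝ × ℝ) =>
      ∫ s in Set.Ioc 0 z.1, g (z.2 + s • v) := by
  have hs : MeasurableSet {w : (ℝ × (ℝ × ℝ)) × ℝ | w.2 ∈ Set.Ioc 0 w.1.1} :=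
    (measurableSet_lt measurable_const measurable_snd).inter
      (measurableSet_le measurable_snd measurable_fst.fst)
  have hm : Measurable fun w : (ℝ × (ℝ × ℝ)) × ℝ => w.1.2 + w.2 • v :=
    (by fun_prop : Continuous fun w : (ℝ × (ℝ × ℝ)) × ℝ => w.1.2 + w.2 • v).measurable
  have := ((hg.comp_measurable hm).indicator hs).integral_prod_right' (ν := volume)
  have e : (fun z : ℝ × (ℝ × ℝ) => ∫ s in Set.Ioc 0 z.1, g (z.2 + s • v)) = fun z =>
      ∫ s, {w : (ℝ × (ℝ × ℝ)) × ℝ | w.2 ∈ Set.Ioc 0 w.1.1}.indicator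
        (g ∘ fun w => w.1.2 + w.2 • v) (z, s) := by
    ext z
    rw [← integral_indicator measurableSet_Ioc]
    rfl
  rw [e]
  exact this

/-- The translation identity holds for every h and almost every p. By Fubini, for almost every y it
relates almost every a ∈ I to almost every b > a, so f(·,y) minus the primitive of g(·,y) is
constant on `I`. The primitive may start at 0 even when 0 ∉ I, since `g` is L² on the whole plane.
-/
theorem ae_exists_primitive {I J : Set ℝ} (hI : IsOpen I) (hJ : IsOpen J)
    (hinv : ∀ a ∈ I, ∀ s : ℝ, 0 ≤ s → a + s ∈ I) {f g : ℝ × ℝ → ℂ}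
    (hf : MemLp f 2 volume) (hg : MemLp g 2 volume) (hw : WeakDerivOn (I ×ˢ J) ex f g) :
    ∀ᵐ y : ℝ, y ∈ J → ∃ c, ∀ᵐ x : ℝ, x ∈ I → f (x, y) = c + ∫ t in 0..x, g (t, y) := by
  -- Strongly measurable representatives make the exceptional set in (h, p) measurable, as Fubini
  -- requires.
  set f' := hf.1.mk f
  set g' := hg.1.mk g
  have ef : f =ᵐ[volume] f' := hf.1.ae_eq_mk
  have eg : g =ᵐ[volume] g' := hg.1.ae_eq_mk
  have mf : StronglyMeasurable f' := hf.1.stronglyMeasurable_mk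
  have mg : StronglyMeasurable g' := hg.1.stronglyMeasurable_mk
  have hf' : MemLp f' 2 volume := (memLp_congr_ae ef).1 hf
  have hg' : MemLp g' 2 volume := (memLp_congr_ae eg).1 hg
  have hw' : WeakDerivOn (I ×ˢ J) ex f' g' := by
    intro φ h1 h2 h3
    have := hw φ h1 h2 h3
    have e1 : ∫ p, (fderiv ℝ φ p ex) • f p = ∫ p, (fderiv ℝ φ p ex) • f' p :=
      integral_congr_ae (ef.mono fun p hp => by simp only [hp])
    have e2 : ∫ p, φ p • g p = ∫ p, φ p • g' p :=
      integral_congr_ae (eg.mono fun p hp => by simp only [hp])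
    rwa [e1, e2] at this
  have hinv' : ∀ p ∈ I ×ˢ J, ∀ s : ℝ, 0 ≤ s → p + s • ex ∈ I ×ˢ J := by
    rintro ⟨a, b⟩ ⟨ha, hb⟩ s hs
    exact ⟨by simpa [ex] using hinv a ha s hs, by simpa [ex] using hb⟩
  have h1 : ∀ᵐ h : ℝ, ∀ᵐ p : ℝ × ℝ, 0 ≤ h → p ∈ I ×ˢ J →
      f' (p + h • ex) = f' p + ∫ s in Set.Ioc 0 h, g' (p + s • ex) := by
    refine ae_of_all _ fun h => ?_
    by_cases hh : 0 ≤ h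
    · filter_upwards [ae_eq_add_integral_translate (hI.prod hJ) hinv'
        (hf'.locallyIntegrable (by norm_num)) (hg'.locallyIntegrable (by norm_num)) hw' hh]
        with p hp _ hpU
      rw [hp hpU, intervalIntegral.integral_of_le hh]
    · exact ae_of_all _ fun p h' => absurd h' hh
  have hm : Measurable fun z : ℝ × (ℝ × ℝ) => z.2 + z.1 • ex :=
    (by fun_prop : Continuous fun z : ℝ × (ℝ × ℝ) => z.2 + z.1 • ex).measurable
  have h2 : ∀ᵐ z : ℝ × (ℝ × ℝ), 0 ≤ z.1 → z.2 ∈ I ×ˢ J →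
      f' (z.2 + z.1 • ex) = f' z.2 + ∫ s in Set.Ioc 0 z.1, g' (z.2 + s • ex) := by
    refine (Measure.ae_prod_iff_ae_ae ?_).2 h1
    refine (measurableSet_le measurable_const measurable_fst).imp
      ((((hI.prod hJ).measurableSet).preimage measurable_snd).imp ?_)
    exact measurableSet_eq_fun (mf.measurable.comp hm) ((mf.measurable.comp measurable_snd).add
      (stronglyMeasurable_translate_integral mg ex).measurable)
  have h3 : ∀ᵐ p : ℝ × ℝ, ∀ᵐ h : ℝ, 0 ≤ h → p ∈ I ×ˢ J →
      f' (p + h • ex) = f' p + ∫ s in Set.Ioc 0 h, g' (p + s • ex) :=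
    Measure.ae_ae_of_ae_prod
      ((Measure.measurePreserving_swap (μ := volume) (ν := volume)).quasiMeasurePreserving.ae h2)
  filter_upwards [ae_ae_slice h3, memLp_slice hg', ae_ae_slice ef, ae_ae_slice eg]
    with y hy hgy efy egy hyJ
  have ig := intervalIntegrable_of_memLp hgy
  obtain ⟨c, hc⟩ := exists_const_of_ae_ae_eq (I := I)
    (k := fun b => f' (b, y) - ∫ t in 0..b, g' (t, y)) (by
      filter_upwards [hy] with a ha haI
      have hsh : ∀ᵐ b : ℝ, 0 ≤ b - a → (a, y) ∈ I ×ˢ J →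
          f' ((a, y) + (b - a) • ex) = f' (a, y) + ∫ s in Set.Ioc 0 (b - a), g' ((a, y) + s • ex) :=
        (measurePreserving_sub_right volume a).quasiMeasurePreserving.ae ha
      filter_upwards [hsh] with b hb hab
      have hb' := hb (by linarith) ⟨haI, hyJ⟩
      rw [← intervalIntegral.integral_of_le (by linarith)] at hb'
      simp only [ex, Prod.smul_mk, smul_eq_mul, mul_one, mul_zero, Prod.mk_add_mk, add_zero,
        add_sub_cancel] at hb'
      rw [intervalIntegral.integral_comp_add_left (fun t => g' (t, y))] at hb'
      simp only [add_zero, add_sub_cancel] at hb'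
      rw [hb', ← intervalIntegral.integral_add_adjacent_intervals (ig 0 a) (ig a b)]
      ring)
  refine ⟨c, ?_⟩
  filter_upwards [hc, efy] with x hx e hxI
  have e2 : ∫ t in 0..x, g (t, y) = ∫ t in 0..x, g' (t, y) :=
    intervalIntegral.integral_congr_ae (egy.mono fun t ht _ => ht)
  rw [e, e2]
  linear_combination hx hxI

/-! ### Traces and Green's formula on a half-plane -/

/-- The half-plane `{σ x > 0}`; it is `rightHalf` for `σ = 1` and `leftHalf` for `σ = -1`. -/
def halfPlane (σ : ℝ) : Set (ℝ × ℝ) := {p | 0 < σ * p.1}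

/-- The trace on the line `x = 0` from the side `σ x > 0`. -/
def tr (σ : ℝ) (f : ℝ × ℝ → ℂ) (y : ℝ) : ℂ := limUnder zeroPlus fun x => f (σ * x, y)

/-- The map `(x, y) ↦ (σ x, y)`. -/
def scaleX (σ : ℝ) (p : ℝ × ℝ) : ℝ × ℝ := (σ * p.1, p.2)

/-- `g` is the weak derivative of `f` in direction `v` on `halfPlane σ`; both are in `L²`. -/
structure SobPair (σ : ℝ) (v : ℝ × ℝ) (f g : ℝ × ℝ → ℂ) : Prop where
  weak : IsWeakDeriv (halfPlane σ) v f g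
  memL : MemLp f 2 (volume.restrict (halfPlane σ))
  memR : MemLp g 2 (volume.restrict (halfPlane σ))

theorem isOpen_halfPlane (σ : ℝ) : IsOpen (halfPlane σ) :=
  isOpen_lt continuous_const (by fun_prop)

theorem measurableSet_halfPlane (σ : ℝ) : MeasurableSet (halfPlane σ) :=
  (isOpen_halfPlane σ).measurableSet

theorem halfPlane_one : halfPlane 1 = rightHalf := by
  ext p; simp [halfPlane, rightHalf]

theorem halfPlane_neg_one : halfPlane (-1) = leftHalf := by
  ext p; simp [halfPlane, leftHalf]

theorem memLp_conj {α : Type*} [MeasurableSpace α] {μ : Measure α} {f : α → ℂ}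
    (hf : MemLp f 2 μ) : MemLp (fun a => conj (f a)) 2 μ :=
  hf.of_le (Complex.continuous_conj.comp_aestronglyMeasurable hf.1)
    (ae_of_all _ fun a => by simp)

theorem HasPrim.conj {F G : ℝ → ℂ} {c : ℂ} (h : HasPrim F G c) :
    HasPrim (fun x => conj (F x)) (fun x => conj (G x)) (conj c) := by
  filter_upwards [h] with x hx h0
  rw [hx h0, map_add, intervalIntegral.integral_of_le h0.le, intervalIntegral.integral_of_le h0.le,
    integral_conj]

section

variable {σ : ℝ}

theorem measurePreserving_scaleX (hσ : σ = 1 ∨ σ = -1) :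
    MeasurePreserving (scaleX σ) volume volume := by
  have h : MeasurePreserving (fun x : ℝ => σ * x) volume volume := by
    rcases hσ with rfl | rfl
    · simp only [one_mul]
      exact MeasurePreserving.id (volume : Measure ℝ)
    · simpa using Measure.measurePreserving_neg (volume : Measure ℝ)
  exact h.prod (MeasurePreserving.id volume)

theorem measurableEmbedding_scaleX (hσ : σ = 1 ∨ σ = -1) : MeasurableEmbedding (scaleX σ) := by
  have hss : σ * σ = 1 := by rcases hσ with rfl | rfl <;> norm_num
  have hi : Function.Involutive (scaleX σ) := fun p => by
    simp [scaleX, ← mul_assoc, hss]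
  have hc : Continuous (scaleX σ) := by unfold scaleX; fun_prop
  exact (hi.toPerm.toHomeomorph (by
    intro s
    constructor
    · intro h
      have := h.preimage hc
      rwa [← Set.preimage_comp, show hi.toPerm _ ∘ scaleX σ = id from hi.comp_self,
        Set.preimage_id] at this
    · exact fun h => h.preimage hc)).measurableEmbedding

theorem scaleX_preimage_halfPlane (hσ : σ = 1 ∨ σ = -1) :
    scaleX σ ⁻¹' halfPlane σ = rightHalf := by
  ext p
  rcases hσ with rfl | rfl <;> simp [scaleX, halfPlane, rightHalf]

theorem indicator_scaleX (hσ : σ = 1 ∨ σ = -1) (f : ℝ × ℝ → ℂ) {x : ℝ} (hx : 0 < x) (y : ℝ) :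
    ((halfPlane σ).indicator f ∘ scaleX σ) (x, y) = f (σ * x, y) := by
  have : scaleX σ (x, y) ∈ halfPlane σ := by
    rw [← Set.mem_preimage, scaleX_preimage_halfPlane hσ]; exact hx
  rw [Function.comp_apply, Set.indicator_of_mem this]; rfl

theorem indicator_scaleX_of_nonpos (hσ : σ = 1 ∨ σ = -1) (f : ℝ × ℝ → ℂ) {x : ℝ} (hx : x ≤ 0)
    (y : ℝ) : ((halfPlane σ).indicator f ∘ scaleX σ) (x, y) = 0 := by
  have : scaleX σ (x, y) ∉ halfPlane σ := by
    rw [← Set.mem_preimage, scaleX_preimage_halfPlane hσ]; exact not_lt.2 hx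
  rw [Function.comp_apply, Set.indicator_of_notMem this]

theorem integral_indicator_scaleX (hσ : σ = 1 ∨ σ = -1) (f : ℝ × ℝ → ℂ) (y : ℝ) :
    ∫ x, ((halfPlane σ).indicator f ∘ scaleX σ) (x, y) = ∫ x in Set.Ioi 0, f (σ * x, y) := by
  rw [← integral_indicator measurableSet_Ioi]
  congr 1; ext x
  by_cases hx : 0 < x
  · rw [indicator_scaleX hσ f hx, Set.indicator_of_mem (Set.mem_Ioi.2 hx)]
  · rw [indicator_scaleX_of_nonpos hσ f (not_lt.1 hx), Set.indicator_of_notMem (by simpa using hx)]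

theorem integrable_halfPlane_fubini (hσ : σ = 1 ∨ σ = -1) {f : ℝ × ℝ → ℂ}
    (hf : IntegrableOn f (halfPlane σ)) :
    Integrable (fun y => ∫ x in Set.Ioi 0, f (σ * x, y)) := by
  have h1 := (measurePreserving_scaleX hσ).integrable_comp_of_integrable
    ((integrable_indicator_iff (measurableSet_halfPlane σ)).2 hf)
  refine h1.integral_prod_right.congr (ae_of_all _ fun y => ?_)
  exact integral_indicator_scaleX hσ f y

theorem setIntegral_halfPlane (hσ : σ = 1 ∨ σ = -1) {f : ℝ × ℝ → ℂ}
    (hf : IntegrableOn f (halfPlane σ)) :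
    ∫ p in halfPlane σ, f p = ∫ y, ∫ x in Set.Ioi 0, f (σ * x, y) := by
  have h1 := (measurePreserving_scaleX hσ).integrable_comp_of_integrable
    ((integrable_indicator_iff (measurableSet_halfPlane σ)).2 hf)
  rw [← integral_indicator (measurableSet_halfPlane σ),
    ← (measurePreserving_scaleX hσ).integral_comp (measurableEmbedding_scaleX hσ)]
  refine (integral_prod_symm _ h1).trans ?_
  congr 1; ext y
  exact integral_indicator_scaleX hσ f y

theorem memLp_indicator_scaleX (hσ : σ = 1 ∨ σ = -1) {f : ℝ × ℝ → ℂ}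
    (hf : MemLp f 2 (volume.restrict (halfPlane σ))) :
    MemLp ((halfPlane σ).indicator f ∘ scaleX σ) 2 volume :=
  ((memLp_indicator_iff_restrict (measurableSet_halfPlane σ)).2 hf).comp_measurePreserving
    (measurePreserving_scaleX hσ)

theorem memLp_slice_halfPlane (hσ : σ = 1 ∨ σ = -1) {f : ℝ × ℝ → ℂ}
    (hf : MemLp f 2 (volume.restrict (halfPlane σ))) :
    ∀ᵐ y : ℝ, MemLp (fun x => f (σ * x, y)) 2 (volume.restrict (Set.Ioi 0)) := by
  filter_upwards [memLp_slice (memLp_indicator_scaleX hσ hf)] with y hy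
  refine (memLp_congr_ae ?_).1 (hy.restrict (Set.Ioi 0))
  filter_upwards [ae_restrict_mem measurableSet_Ioi] with x hx
  exact indicator_scaleX hσ f hx y

theorem WeakDerivOn.neg_left {U : Set (ℝ × ℝ)} {v : ℝ × ℝ} {f g : ℝ × ℝ → ℂ}
    (h : WeakDerivOn U (-v) f g) : WeakDerivOn U v f (-g) := by
  intro φ h1 h2 h3
  have := h φ h1 h2 h3
  simp only [map_neg, neg_smul, integral_neg] at this
  simp only [Pi.neg_apply, smul_neg, integral_neg]
  rw [← this, neg_neg]

/-- Both half-planes are treated at once by reflecting the left one onto the right; the factor σ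
comes from the chain rule. -/
theorem weakDerivOn_indicator_scaleX (hσ : σ = 1 ∨ σ = -1) {f g : ℝ × ℝ → ℂ}
    (h : IsWeakDeriv (halfPlane σ) ex f g) :
    WeakDerivOn rightHalf ex ((halfPlane σ).indicator f ∘ scaleX σ)
      ((σ : ℂ) • ((halfPlane σ).indicator g ∘ scaleX σ)) := by
  have hw := h.weakDerivOn_indicator (measurableSet_halfPlane σ)
  have hmp := measurePreserving_scaleX hσ
  have hpre := scaleX_preimage_halfPlane hσ
  rcases hσ with rfl | rfl
  · have e : scaleX 1 = id := by ext p <;> simp [scaleX]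
    rw [e] at hpre ⊢
    simpa [← hpre] using hw
  · set T : (ℝ × ℝ) ≃L[ℝ] (ℝ × ℝ) :=
      (ContinuousLinearEquiv.neg ℝ).prodCongr (ContinuousLinearEquiv.refl ℝ ℝ)
    have eT : (T : ℝ × ℝ → ℝ × ℝ) = scaleX (-1) := by
      ext p <;> simp [scaleX, T]
    have ev : T.symm ex = -ex := by
      rw [ContinuousLinearEquiv.symm_apply_eq]; simp [T, ex]
    have := hw.comp_equiv T (by rw [eT]; exact hmp)
    rw [ev, eT, hpre] at this
    simpa using this.neg_left

theorem SobPair.ae_hasPrim (hσ : σ = 1 ∨ σ = -1) {f g : ℝ × ℝ → ℂ} (h : SobPair σ ex f g) :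
    ∀ᵐ y : ℝ, ∃ c, HasPrim (fun x => f (σ * x, y)) (fun x => σ * g (σ * x, y)) c := by
  have hw := weakDerivOn_indicator_scaleX hσ h.weak
  have er : rightHalf = Set.Ioi (0 : ℝ) ×ˢ (Set.univ : Set ℝ) := by
    ext p; simp [rightHalf]
  rw [er] at hw
  filter_upwards [ae_exists_primitive isOpen_Ioi isOpen_univ
    (fun a ha s hs => by simp only [Set.mem_Ioi] at *; linarith)
    (memLp_indicator_scaleX hσ h.memL) ((memLp_indicator_scaleX hσ h.memR).const_smul (σ : ℂ)) hw]
    with y hy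
  obtain ⟨c, hc⟩ := hy (Set.mem_univ y)
  refine ⟨c, ?_⟩
  filter_upwards [hc] with x hx h0
  rw [← indicator_scaleX hσ f h0, hx h0]
  congr 1
  refine intervalIntegral.integral_congr_ae (ae_of_all _ fun t ht => ?_)
  rw [Set.uIoc_of_le h0.le] at ht
  simp only [Pi.smul_apply, smul_eq_mul]
  rw [indicator_scaleX hσ g ht.1]

theorem SobPair.ae_hasPrim_tr (hσ : σ = 1 ∨ σ = -1) {f g : ℝ × ℝ → ℂ} (h : SobPair σ ex f g) :
    ∀ᵐ y : ℝ, HasPrim (fun x => f (σ * x, y)) (fun x => σ * g (σ * x, y)) (tr σ f y) ∧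
      Tendsto (fun x => f (σ * x, y)) zeroPlus (𝓝 (tr σ f y)) := by
  filter_upwards [h.ae_hasPrim hσ, memLp_slice_halfPlane hσ h.memR] with y ⟨c, hc⟩ hg
  have ht := hc.tendsto (hg.const_mul _)
  have e : tr σ f y = c := ht.limUnder_eq
  rw [e]
  exact ⟨hc, ht⟩

theorem SobPair.ae_integral_slice (hσ : σ = 1 ∨ σ = -1) {f g u v : ℝ × ℝ → ℂ}
    (h : SobPair σ ex f g) (h' : SobPair σ ex u v) :
    ∀ᵐ y : ℝ, ∫ x in Set.Ioi 0,
      (conj (f (σ * x, y)) * v (σ * x, y) + conj (g (σ * x, y)) * u (σ * x, y)) =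
        -σ * (conj (tr σ f y) * tr σ u y) := by
  have hss : (σ : ℂ) * σ = 1 := by rcases hσ with rfl | rfl <;> norm_num
  filter_upwards [h.ae_hasPrim_tr hσ, h'.ae_hasPrim_tr hσ, memLp_slice_halfPlane hσ h.memL,
    memLp_slice_halfPlane hσ h.memR, memLp_slice_halfPlane hσ h'.memL,
    memLp_slice_halfPlane hσ h'.memR] with y h1 h2 l1 l2 l3 l4
  have := h1.1.conj.integral_mul h2.1 (memLp_conj l1) (memLp_conj (l2.const_mul _)) l3
    (l4.const_mul _)
  have e : (σ : ℂ) * ∫ x in Set.Ioi 0,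
      (conj (f (σ * x, y)) * v (σ * x, y) + conj (g (σ * x, y)) * u (σ * x, y)) =
      -(conj (tr σ f y) * tr σ u y) := by
    rw [← this, ← integral_const_mul]
    congr 1; ext x
    simp only [map_mul, Complex.conj_ofReal]
    ring
  -- Each derivative along the reflected line carries a factor σ; multiplying by σ once more uses σ²
  -- = 1.
  linear_combination (σ : ℂ) * e - (∫ x in Set.Ioi 0,
      (conj (f (σ * x, y)) * v (σ * x, y) + conj (g (σ * x, y)) * u (σ * x, y))) * hss

theorem SobPair.integrableOn {w w' : ℝ × ℝ} {f g u v : ℝ × ℝ → ℂ} (h : SobPair σ w f g)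
    (h' : SobPair σ w' u v) :
    IntegrableOn (fun p => conj (f p) * v p + conj (g p) * u p) (halfPlane σ) :=
  ((memLp_conj h.memL).integrable_mul h'.memR).add ((memLp_conj h.memR).integrable_mul h'.memL)

/-- Green's formula in the direction transversal to the boundary. -/
theorem SobPair.green_x (hσ : σ = 1 ∨ σ = -1) {f g u v : ℝ × ℝ → ℂ} (h : SobPair σ ex f g)
    (h' : SobPair σ ex u v) :
    ∫ p in halfPlane σ, (conj (f p) * v p + conj (g p) * u p) =
      -σ * ∫ y, conj (tr σ f y) * tr σ u y := by
  rw [setIntegral_halfPlane hσ (h.integrableOn h'), ← integral_const_mul]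
  exact integral_congr_ae (h.ae_integral_slice hσ h')

/-- The trace is measurable. -/
theorem SobPair.aestronglyMeasurable_tr (hσ : σ = 1 ∨ σ = -1) {f g : ℝ × ℝ → ℂ}
    (h : SobPair σ ex f g) : AEStronglyMeasurable (tr σ f) volume := by
  set F := (halfPlane σ).indicator f ∘ scaleX σ
  set G := (halfPlane σ).indicator g ∘ scaleX σ
  have mF : AEStronglyMeasurable F volume := (memLp_indicator_scaleX hσ h.memL).1
  have mG : AEStronglyMeasurable G volume := (memLp_indicator_scaleX hσ h.memR).1
  -- Integration by parts against e^{-x} writes the trace as ∫₀^∞ e^{-x} (f − σ g)(σx, y) dx. A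
  -- parameter integral is measurable in y, which is not evident for an essential limit.
  have mE : Continuous fun p : ℝ × ℝ => (Real.exp (-p.1) : ℂ) := by fun_prop
  have mK : AEStronglyMeasurable
      (fun p : ℝ × ℝ => (Real.exp (-p.1) : ℂ) * (F p - σ * G p)) volume :=
    mE.aestronglyMeasurable.mul (mF.sub (mG.const_mul _))
  have mI := (AEStronglyMeasurable.prod_swap (μ := volume) (ν := volume) mK).integral_prod_right'
  refine mI.congr ?_
  filter_upwards [h.ae_hasPrim_tr hσ, memLp_slice_halfPlane hσ h.memL,
    memLp_slice_halfPlane hσ h.memR] with y h1 l1 l2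
  have lE : MemLp (fun x : ℝ => (Real.exp (-x) : ℂ)) 2 (volume.restrict (Set.Ioi 0)) := by
    rw [memLp_two_iff_integrable_sq_norm (by fun_prop)]
    have : IntegrableOn (fun x : ℝ => Real.exp (-2 * x)) (Set.Ioi 0) :=
      integrableOn_exp_mul_Ioi (by norm_num) 0
    refine this.congr (ae_of_all _ fun x => ?_)
    simp only
    rw [Complex.norm_real, Real.norm_of_nonneg (Real.exp_pos _).le, ← Real.exp_nat_mul]
    congr 1; push_cast; ring
  have hE : HasPrim (fun x : ℝ => (Real.exp (-x) : ℂ)) (fun x => -(Real.exp (-x) : ℂ)) 1 := by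
    refine ae_of_all _ fun x _ => ?_
    have hd : ∀ t : ℝ, HasDerivAt (fun t : ℝ => (Real.exp (-t) : ℂ)) (-(Real.exp (-t) : ℂ)) t := by
      intro t
      have := ((hasDerivAt_neg t).exp).ofReal_comp
      convert! this using 1
      push_cast; ring
    rw [intervalIntegral.integral_eq_sub_of_hasDerivAt (fun t _ => hd t)
      ((by fun_prop : Continuous fun t : ℝ => -(Real.exp (-t) : ℂ)).intervalIntegrable _ _)]
    simp
  have := h1.1.integral_mul hE l1 (l2.const_mul _) lE lE.neg
  rw [mul_one] at this
  rw [← neg_neg (tr σ f y), ← this, ← integral_neg, ← integral_indicator measurableSet_Ioi]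
  congr 1; ext x
  by_cases hx : 0 < x
  · rw [Set.indicator_of_mem (Set.mem_Ioi.2 hx)]
    simp only [Prod.swap_prod_mk]
    rw [show F (x, y) = _ from indicator_scaleX hσ f hx y,
      show G (x, y) = _ from indicator_scaleX hσ g hx y]
    ring
  · rw [Set.indicator_of_notMem (by simpa using hx)]
    simp only [Prod.swap_prod_mk]
    rw [show F (x, y) = _ from indicator_scaleX_of_nonpos hσ f (not_lt.1 hx) y,
      show G (x, y) = _ from indicator_scaleX_of_nonpos hσ g (not_lt.1 hx) y]
    ring

/-- By one-dimensional integration by parts, |tr f|² equals −σ ∫ 2 Re(conj f · g) dx. The weight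
depends on y only and can be attached to `f` alone, so `m f` and `g` in L² suffice. -/
theorem SobPair.integrable_weight_tr (hσ : σ = 1 ∨ σ = -1) {f g : ℝ × ℝ → ℂ}
    (h : SobPair σ ex f g) {m : ℝ → ℝ}
    (hm : MemLp (fun p => (m p.2 : ℂ) * f p) 2 (volume.restrict (halfPlane σ))) :
    Integrable (fun y => m y * ‖tr σ f y‖ ^ 2) := by
  have hss : (σ : ℂ) * σ = 1 := by rcases hσ with rfl | rfl <;> norm_num
  have i0 : IntegrableOn (fun p => conj ((m p.2 : ℂ) * f p) * g p + conj (g p) * ((m p.2 : ℂ) * f p))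
      (halfPlane σ) :=
    ((memLp_conj hm).integrable_mul h.memR).add ((memLp_conj h.memR).integrable_mul hm)
  have i1 := ((integrable_halfPlane_fubini hσ i0).const_mul (-(σ : ℂ))).re
  refine i1.congr ?_
  filter_upwards [h.ae_integral_slice hσ h] with y hy
  have e : ∫ x in Set.Ioi 0, (conj ((m y : ℂ) * f (σ * x, y)) * g (σ * x, y) +
      conj (g (σ * x, y)) * ((m y : ℂ) * f (σ * x, y))) = (m y : ℂ) * (-σ * (conj (tr σ f y) * tr σ f y)) := by
    rw [← hy, ← integral_const_mul]
    congr 1; ext x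
    simp only [map_mul, Complex.conj_ofReal]
    ring
  simp only [e]
  have e2 : -(σ : ℂ) * ((m y : ℂ) * (-σ * (conj (tr σ f y) * tr σ f y))) =
      ((m y * ‖tr σ f y‖ ^ 2 : ℝ) : ℂ) := by
    have : conj (tr σ f y) * tr σ f y = ((‖tr σ f y‖ ^ 2 : ℝ) : ℂ) := by
      rw [mul_comm, Complex.mul_conj, Complex.normSq_eq_norm_sq]
    rw [this]; push_cast
    linear_combination (m y : ℂ) * (‖tr σ f y‖ : ℂ) ^ 2 * hss
  rw [e2]; exact Complex.ofReal_re _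

theorem SobPair.memLp_tr (hσ : σ = 1 ∨ σ = -1) {f g : ℝ × ℝ → ℂ} (h : SobPair σ ex f g) :
    MemLp (tr σ f) 2 volume := by
  rw [memLp_two_iff_integrable_sq_norm (h.aestronglyMeasurable_tr hσ)]
  have := h.integrable_weight_tr hσ (m := fun _ => 1) (by simpa using h.memL)
  simpa using this

theorem SobPair.memLp_weight_tr (hσ : σ = 1 ∨ σ = -1) {f g : ℝ × ℝ → ℂ} (h : SobPair σ ex f g)
    (hy : MemLp (fun p => (p.2 : ℂ) * f p) 2 (volume.restrict (halfPlane σ))) :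
    MemLp (fun y => ((√|y| : ℝ) : ℂ) * tr σ f y) 2 volume := by
  have hc : Continuous fun y : ℝ => ((√|y| : ℝ) : ℂ) := by fun_prop
  refine (memLp_two_iff_integrable_sq_norm
    (hc.aestronglyMeasurable.mul (h.aestronglyMeasurable_tr hσ))).2 ?_
  have hm : MemLp (fun p => ((|p.2| : ℝ) : ℂ) * f p) 2 (volume.restrict (halfPlane σ)) := by
    have hc' : Continuous fun p : ℝ × ℝ => ((|p.2| : ℝ) : ℂ) := by fun_prop
    refine hy.of_le (hc'.aestronglyMeasurable.mul h.memL.1) (ae_of_all _ fun p => ?_)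
    simp
  refine (h.integrable_weight_tr hσ (m := fun y => |y|) hm).congr (ae_of_all _ fun y => ?_)
  simp [mul_pow, Real.sq_sqrt]

/-- Green's formula in the direction parallel to the boundary. -/
theorem SobPair.green_y {f g u v : ℝ × ℝ → ℂ} (h : SobPair σ ey f g) (h' : SobPair σ ey u v) :
    ∫ p in halfPlane σ, (conj (f p) * v p + conj (g p) * u p) = 0 := by
  -- Swapping coordinates turns `ey` into `ex`. Lines parallel to the boundary stay in the
  -- half-plane, so the whole-line formula applies and no boundary term appears.
  set S : (ℝ × ℝ) ≃L[ℝ] (ℝ × ℝ) := ContinuousLinearEquiv.prodComm ℝ ℝ ℝ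
  have hS : MeasurePreserving S volume volume := Measure.measurePreserving_swap
  have hpre : S ⁻¹' halfPlane σ = Set.univ ×ˢ {y : ℝ | 0 < σ * y} := by
    ext p; simp [S, halfPlane]
  have hv : S.symm ey = ex := by
    rw [ContinuousLinearEquiv.symm_apply_eq]; simp [S, ex, ey]
  have hJ : IsOpen {y : ℝ | 0 < σ * y} := isOpen_lt continuous_const (by fun_prop)
  have memS : ∀ {f : ℝ × ℝ → ℂ}, MemLp f 2 (volume.restrict (halfPlane σ)) →
      MemLp ((halfPlane σ).indicator f ∘ S) 2 volume := fun hf =>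
    ((memLp_indicator_iff_restrict (measurableSet_halfPlane σ)).2 hf).comp_measurePreserving hS
  have prim : ∀ {f g : ℝ × ℝ → ℂ}, SobPair σ ey f g → ∀ᵐ x : ℝ, 0 < σ * x → ∃ c, ∀ᵐ y : ℝ,
      f (x, y) = c + ∫ t in 0..y, g (x, t) := by
    intro f g h
    have hw := (h.weak.weakDerivOn_indicator (measurableSet_halfPlane σ)).comp_equiv S hS
    rw [hpre, hv] at hw
    filter_upwards [ae_exists_primitive isOpen_univ hJ (fun _ _ _ _ => trivial) (memS h.memL)
      (memS h.memR) hw] with x hx hpos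
    obtain ⟨c, hc⟩ := hx hpos
    refine ⟨c, hc.mono fun y hy => ?_⟩
    have hmem : ∀ t, (x, t) ∈ halfPlane σ := fun t => hpos
    simpa [S, hmem] using hy trivial
  have slice : ∀ {f : ℝ × ℝ → ℂ}, MemLp f 2 (volume.restrict (halfPlane σ)) → ∀ᵐ x : ℝ,
      0 < σ * x → MemLp (fun y => f (x, y)) 2 volume := by
    intro f hf
    filter_upwards [memLp_slice (memS hf)] with x hx hpos
    have hmem : ∀ t, (x, t) ∈ halfPlane σ := fun t => hpos
    simpa [S, hmem] using hx
  have hi := (integrable_indicator_iff (measurableSet_halfPlane σ)).2 (h.integrableOn h')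
  rw [← integral_indicator (measurableSet_halfPlane σ)]
  refine (integral_prod _ hi).trans (integral_eq_zero_of_ae ?_)
  filter_upwards [prim h, prim h', slice h.memL, slice h.memR, slice h'.memL, slice h'.memR]
    with x p1 p2 l1 l2 l3 l4
  by_cases hpos : 0 < σ * x
  · obtain ⟨c, hc⟩ := p1 hpos
    obtain ⟨d, hd⟩ := p2 hpos
    have hmem : ∀ t, (x, t) ∈ halfPlane σ := fun t => hpos
    have hc' : ∀ᵐ y : ℝ, conj (f (x, y)) = conj c + ∫ t in 0..y, conj (g (x, t)) := by
      filter_upwards [hc] with y hy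
      rw [hy, map_add, intervalIntegral, intervalIntegral, integral_conj, integral_conj, map_sub]
    have := integral_mul_eq_zero_of_primitive hc' hd (memLp_conj (l1 hpos)) (memLp_conj (l2 hpos))
      (l3 hpos) (l4 hpos)
    simpa [hmem] using this
  · have hmem : ∀ t, (x, t) ∉ halfPlane σ := fun t => hpos
    simp [hmem]

end

/-! ### The broken Sobolev spaces -/

theorem IsWeakDeriv.congr {U : Set (ℝ × ℝ)} (hU : IsOpen U) {v : ℝ × ℝ} {f g f' g' : ℝ × ℝ → ℂ}
    (h : IsWeakDeriv U v f g) (hf : Set.EqOn f f' U) (hg : Set.EqOn g g' U) :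
    IsWeakDeriv U v f' g' := by
  have hf' : f =ᵐ[volume.restrict U] f' := by
    filter_upwards [ae_restrict_mem hU.measurableSet] with p hp using hf hp
  have hg' : g =ᵐ[volume.restrict U] g' := by
    filter_upwards [ae_restrict_mem hU.measurableSet] with p hp using hg hp
  have loc : ∀ {a b : ℝ × ℝ → ℂ}, a =ᵐ[volume.restrict U] b → LocallyIntegrableOn a U volume →
      LocallyIntegrableOn b U volume := by
    intro a b hab ha
    rw [locallyIntegrableOn_iff hU.isLocallyClosed] at ha ⊢
    intro K hKU hK
    exact (ha K hKU hK).congr (ae_mono (Measure.restrict_mono_set _ hKU) hab)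
  refine ⟨loc hf' h.1, loc hg' h.2.1, fun φ h1 h2 h3 => ?_⟩
  have := h.2.2 φ h1 h2 h3
  have e1 : ∫ p in U, (fderiv ℝ φ p v) • f p = ∫ p in U, (fderiv ℝ φ p v) • f' p :=
    integral_congr_ae (hf'.mono fun p hp => by simp only [hp])
  have e2 : ∫ p in U, φ p • g p = ∫ p in U, φ p • g' p :=
    integral_congr_ae (hg'.mono fun p hp => by simp only [hp])
  rwa [e1, e2] at this

theorem integrable_smul_of_locallyIntegrableOn {U : Set (ℝ × ℝ)} {k : ℝ × ℝ → ℂ}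
    (hk : LocallyIntegrableOn k U volume) {φ : ℝ × ℝ → ℝ} (h1 : Continuous φ)
    (h2 : HasCompactSupport φ) (h3 : tsupport φ ⊆ U) : Integrable (fun p => φ p • k p) := by
  have hK : IsCompact (tsupport φ) := h2
  have i := (hk.integrableOn_compact_subset h3 hK).continuousOn_smul h1.continuousOn hK
  refine (integrableOn_iff_integrable_of_support_subset fun p hp => ?_).1 i
  by_contra hn
  exact hp (by simp [image_eq_zero_of_notMem_tsupport hn])

theorem IsWeakDeriv.ae_eq {U : Set (ℝ × ℝ)} (hU : IsOpen U) {v : ℝ × ℝ} {f g g' : ℝ × ℝ → ℂ}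
    (h : IsWeakDeriv U v f g) (h' : IsWeakDeriv U v f g') : g =ᵐ[volume.restrict U] g' := by
  have key := hU.ae_eq_zero_of_integral_contDiff_smul_eq_zero (μ := volume)
    (f := fun p => g p - g' p) (h.2.1.sub h'.2.1) (by
      intro φ h1 h2 h3
      have int : ∀ {k : ℝ × ℝ → ℂ}, LocallyIntegrableOn k U volume →
          Integrable (fun p => φ p • k p) := fun hk =>
        integrable_smul_of_locallyIntegrableOn hk h1.continuous h2 h3
      have sup : ∀ k : ℝ × ℝ → ℂ, ∫ p in U, φ p • k p = ∫ p, φ p • k p := fun k =>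
        setIntegral_eq_integral_of_forall_compl_eq_zero fun p hp => by
          rw [image_eq_zero_of_notMem_tsupport (fun hm => hp (h3 hm)), zero_smul]
      simp only [smul_sub]
      rw [integral_sub (int h.2.1) (int h'.2.1), ← sup, ← sup, sub_eq_zero]
      exact neg_injective ((h.2.2 φ h1 h2 h3).symm.trans (h'.2.2 φ h1 h2 h3)))
  rw [Filter.EventuallyEq, ae_restrict_iff' hU.measurableSet]
  filter_upwards [key] with p hp hpU using sub_eq_zero.1 (hp hpU)

/-- `weakDeriv` is an arbitrary choice; uniqueness up to null sets transfers to it the L² bound of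
any other weak derivative. -/
theorem isWeakDeriv_weakDeriv {U : Set (ℝ × ℝ)} (hU : IsOpen U) {v : ℝ × ℝ} {f : ℝ × ℝ → ℂ}
    (h : ∃ g, IsWeakDeriv U v f g ∧ MemLp g 2 (volume.restrict U)) :
    IsWeakDeriv U v f (weakDeriv U v f) ∧ MemLp (weakDeriv U v f) 2 (volume.restrict U) := by
  obtain ⟨g, hg, hL⟩ := h
  have hex : ∃ g, IsWeakDeriv U v f g := ⟨g, hg⟩
  have hw : IsWeakDeriv U v f (weakDeriv U v f) := by
    rw [weakDeriv, dif_pos hex]; exact hex.choose_spec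
  exact ⟨hw, (memLp_congr_ae (hg.ae_eq hU hw)).1 hL⟩

theorem memH1_halfPlane {σ : ℝ} (hσ : σ = 1 ∨ σ = -1) {Ψ : ℝ × ℝ → ℂ} (h : MemH1Sum Ψ) :
    MemH1 (halfPlane σ) Ψ := by
  rcases hσ with rfl | rfl
  · rw [halfPlane_one]; exact h.1
  · rw [halfPlane_neg_one]; exact h.2

theorem sobPair_of_eqOn {σ : ℝ} {v : ℝ × ℝ} {f g : ℝ × ℝ → ℂ}
    (hf : MemLp f 2 (volume.restrict (halfPlane σ)))
    (h : ∃ g, IsWeakDeriv (halfPlane σ) v f g ∧ MemLp g 2 (volume.restrict (halfPlane σ)))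
    (e : Set.EqOn (weakDeriv (halfPlane σ) v f) g (halfPlane σ)) : SobPair σ v f g := by
  obtain ⟨h1, h2⟩ := isWeakDeriv_weakDeriv (isOpen_halfPlane σ) h
  refine ⟨h1.congr (isOpen_halfPlane σ) (fun _ _ => rfl) e, hf, (memLp_congr_ae ?_).1 h2⟩
  filter_upwards [ae_restrict_mem (measurableSet_halfPlane σ)] with p hp using e hp

theorem MemH1Sum.sobPair_dx {σ : ℝ} (hσ : σ = 1 ∨ σ = -1) {Ψ : ℝ × ℝ → ℂ} (h : MemH1Sum Ψ) :
    SobPair σ ex Ψ (dx Ψ) := by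
  have hh := memH1_halfPlane hσ h
  refine sobPair_of_eqOn hh.1 hh.2.1 fun p hp => ?_
  rcases hσ with rfl | rfl
  · rw [halfPlane_one] at hp ⊢
    have hp' : 0 < p.1 := hp
    simp [dx, hp']
  · rw [halfPlane_neg_one] at hp ⊢
    have hp' : ¬ 0 < p.1 := not_lt.2 (le_of_lt hp)
    simp [dx, hp']

theorem MemH1Sum.sobPair_dy {σ : ℝ} (hσ : σ = 1 ∨ σ = -1) {Ψ : ℝ × ℝ → ℂ} (h : MemH1Sum Ψ) :
    SobPair σ ey Ψ (dy Ψ) := by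
  have hh := memH1_halfPlane hσ h
  refine sobPair_of_eqOn hh.1 hh.2.2 fun p hp => ?_
  rcases hσ with rfl | rfl
  · rw [halfPlane_one] at hp ⊢
    have hp' : 0 < p.1 := hp
    simp [dy, hp']
  · rw [halfPlane_neg_one] at hp ⊢
    have hp' : ¬ 0 < p.1 := not_lt.2 (le_of_lt hp)
    simp [dy, hp']

theorem ae_fst_ne_zero : ∀ᵐ p : ℝ × ℝ, p.1 ≠ 0 :=
  Measure.quasiMeasurePreserving_fst.ae (Measure.ae_ne volume (0 : ℝ))

theorem restrict_halfPlanes :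
    volume.restrict (halfPlane 1 ∪ halfPlane (-1)) = (volume : Measure (ℝ × ℝ)) := by
  refine Measure.restrict_eq_self_of_ae_mem ?_
  filter_upwards [ae_fst_ne_zero] with p hp
  rcases lt_or_gt_of_ne hp with h | h
  · exact Or.inr (by simpa [halfPlane] using h)
  · exact Or.inl (by simpa [halfPlane] using h)

theorem disjoint_halfPlanes : Disjoint (halfPlane 1) (halfPlane (-1)) :=
  Set.disjoint_left.2 fun p h1 h2 => by
    simp only [halfPlane, Set.mem_ofPred_eq] at h1 h2; linarith

theorem integral_eq_add_halfPlanes {f : ℝ × ℝ → ℂ} (hf : Integrable f) :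
    ∫ p, f p = (∫ p in halfPlane 1, f p) + ∫ p in halfPlane (-1), f p := by
  rw [← setIntegral_union disjoint_halfPlanes (measurableSet_halfPlane _) hf.integrableOn
    hf.integrableOn, restrict_halfPlanes]

theorem memLp_of_halfPlanes {f : ℝ × ℝ → ℂ}
    (h : ∀ σ : ℝ, σ = 1 ∨ σ = -1 → MemLp f 2 (volume.restrict (halfPlane σ))) :
    MemLp f 2 volume := by
  have h1 := (memLp_indicator_iff_restrict (measurableSet_halfPlane _)).2 (h 1 (Or.inl rfl))
  have h2 := (memLp_indicator_iff_restrict (measurableSet_halfPlane _)).2 (h (-1) (Or.inr rfl))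
  refine (memLp_congr_ae ?_).1 (h1.add h2)
  filter_upwards [ae_fst_ne_zero] with p hp
  rcases lt_or_gt_of_ne hp with h | h
  · have m1 : p ∉ halfPlane 1 := by simpa [halfPlane] using h.le
    have m2 : p ∈ halfPlane (-1) := by simpa [halfPlane] using h
    simp [m1, m2]
  · have m1 : p ∈ halfPlane 1 := by simpa [halfPlane] using h
    have m2 : p ∉ halfPlane (-1) := by simpa [halfPlane] using h.le
    simp [m1, m2]

theorem MemH1Sum.memLp {Ψ : ℝ × ℝ → ℂ} (h : MemH1Sum Ψ) : MemLp Ψ 2 volume :=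
  memLp_of_halfPlanes fun _ hσ => (memH1_halfPlane hσ h).1

theorem MemH1Sum.memLp_dx {Ψ : ℝ × ℝ → ℂ} (h : MemH1Sum Ψ) : MemLp (dx Ψ) 2 volume :=
  memLp_of_halfPlanes fun _ hσ => (h.sobPair_dx hσ).memR

theorem MemH1Sum.memLp_dy {Ψ : ℝ × ℝ → ℂ} (h : MemH1Sum Ψ) : MemLp (dy Ψ) 2 volume :=
  memLp_of_halfPlanes fun _ hσ => (h.sobPair_dy hσ).memR

/-- The derivative terms of `a0Density` are integrable for every broken H¹ function, so only the
potential term is a condition. -/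
theorem mem_formDom_iff {Ψ : ℝ × ℝ → ℂ} :
    Ψ ∈ formDom ↔ MemH1Sum Ψ ∧ MemLp (fun p => (p.2 : ℂ) * Ψ p) 2 volume := by
  have hc : Continuous fun p : ℝ × ℝ => (p.2 : ℂ) := by fun_prop
  constructor
  · rintro ⟨h, hi⟩
    refine ⟨h, ?_⟩
    have hm : AEStronglyMeasurable (fun p => (p.2 : ℂ) * Ψ p) volume :=
      hc.aestronglyMeasurable.mul h.memLp.1
    rw [memLp_two_iff_integrable_sq_norm hm]
    refine (hi.const_mul 2).mono' (hm.norm.pow 2) (ae_of_all _ fun p => ?_)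
    rw [Real.norm_of_nonneg (by positivity), norm_mul, mul_pow, Complex.norm_real,
      Real.norm_eq_abs, sq_abs, a0Density]
    nlinarith [sq_nonneg ‖dx Ψ p‖, sq_nonneg ‖dy Ψ p‖]
  · rintro ⟨h, hy⟩
    refine ⟨h, ?_⟩
    have i1 := (memLp_two_iff_integrable_sq_norm h.memLp_dx.1).1 h.memLp_dx
    have i2 := (memLp_two_iff_integrable_sq_norm h.memLp_dy.1).1 h.memLp_dy
    have i3 := (memLp_two_iff_integrable_sq_norm hy.1).1 hy
    refine ((i1.add (i2.const_mul (1 / 2))).add (i3.const_mul (1 / 2))).congr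
      (ae_of_all _ fun p => ?_)
    simp only [Pi.add_apply, norm_mul, mul_pow, Complex.norm_real, Real.norm_eq_abs, sq_abs,
      a0Density]
    ring

theorem trP_eq_tr (Ψ : ℝ × ℝ → ℂ) : trP Ψ = tr 1 Ψ := by
  ext y; simp [trP, tr]

theorem zeroMinus_eq_map : zeroMinus = map (fun x : ℝ => -x) zeroPlus := by
  have hae : Tendsto (fun x : ℝ => -x) (ae volume) (ae volume) :=
    (Measure.measurePreserving_neg (volume : Measure ℝ)).quasiMeasurePreserving.tendsto_ae
  have h1 : Tendsto (fun x : ℝ => -x) (𝓝[>] 0) (𝓝[<] 0) := by simpa using tendsto_neg_nhdsGT (a := (0 : ℝ))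
  have h2 : Tendsto (fun x : ℝ => -x) (𝓝[<] 0) (𝓝[>] 0) := by simpa using tendsto_neg_nhdsLT (a := (0 : ℝ))
  have t1 : Tendsto (fun x : ℝ => -x) zeroPlus zeroMinus := hae.inf h1
  have t2 : Tendsto (fun x : ℝ => -x) zeroMinus zeroPlus := hae.inf h2
  refine le_antisymm ?_ t1
  have := map_mono (m := fun x : ℝ => -x) t2
  rwa [map_map, show (fun x : ℝ => -x) ∘ (fun x : ℝ => -x) = id by ext; simp, map_id] at this

theorem trM_eq_tr (Ψ : ℝ × ℝ → ℂ) : trM Ψ = tr (-1) Ψ := by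
  ext y
  rw [trM, tr, zeroMinus_eq_map, limUnder, limUnder, map_map]
  congr 2
  ext x; simp

/-! ### The operator and the form -/

theorem integrable_conj_mul {α : Type*} [MeasurableSpace α] {μ : Measure α} {f g : α → ℂ}
    (hf : MemLp f 2 μ) (hg : MemLp g 2 μ) : Integrable (fun a => conj (f a) * g a) μ :=
  (memLp_conj hf).integrable_mul hg

/-- The boundary term produced by Green's formula, for two functions with sums and jumps
`S`, `J` and normal derivatives with sums and jumps `s`, `j`. -/
def greenDensity (S J s j : ℂ) : ℂ := 1 / 2 * (conj S * j + conj J * s)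

/-- The integrand of the boundary part of the sesquilinear form. -/
def formDensity (α β : ℝ) (γ : ℂ) (y : ℝ) (S J s j : ℂ) : ℂ :=
  if β = 0 then ((α / 4 * y : ℝ) : ℂ) * (conj S * s)
  else 1 / (β : ℂ) * ((y : ℂ) * (conj J * j) +
    (((α * β + ‖γ‖ ^ 2) / 4 * y : ℝ) : ℂ) * (conj S * s) +
    (y : ℂ) * (1 / 2) * (γ * conj S * j + conj γ * conj J * s))

/-- The right side is what Green's formula yields from the two sides of the line; the left side is
adapted to the coupling conditions. -/
theorem greenDensity_eq (a b c d : ℂ) :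
    greenDensity (a + b) (a - b) (c + d) (c - d) = conj a * c - conj b * d := by
  simp only [greenDensity, map_add, map_sub]; ring

/-- Pointwise, conj Φ · ℋΨ = Q − A − B/2, where A and B are the x- and y-derivatives of conj Φ ·
∂Ψ/∂x and conj Φ · ∂Ψ/∂y. Then ∫ B = 0, and ∫ A is minus the boundary integral. -/
theorem green_formula {Φ Ψ : ℝ × ℝ → ℂ} (hΦ : Φ ∈ formDom) (hΨ : Ψ ∈ formDom)
    (h2 : MemH2Sum Ψ) :
    Integrable (fun p => conj (Φ p) * hamExpr Ψ p) ∧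
    Integrable (fun y => greenDensity (fSum Φ y) (fJump Φ y) (fSum (dx Ψ) y) (fJump (dx Ψ) y)) ∧
    a0S Φ Ψ = (∫ p, conj (Φ p) * hamExpr Ψ p) -
      ∫ y, greenDensity (fSum Φ y) (fJump Φ y) (fSum (dx Ψ) y) (fJump (dx Ψ) y) := by
  obtain ⟨f1, fy⟩ := mem_formDom_iff.1 hΦ
  obtain ⟨p1, py⟩ := mem_formDom_iff.1 hΨ
  obtain ⟨-, px, pd⟩ := h2
  have o1 : (1 : ℝ) = 1 ∨ (1 : ℝ) = -1 := Or.inl rfl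
  have o2 : (-1 : ℝ) = 1 ∨ (-1 : ℝ) = -1 := Or.inr rfl
  set A : ℝ × ℝ → ℂ := fun p => conj (Φ p) * dx (dx Ψ) p + conj (dx Φ p) * dx Ψ p with hA
  set B : ℝ × ℝ → ℂ := fun p => conj (Φ p) * dy (dy Ψ) p + conj (dy Φ p) * dy Ψ p with hB
  set Q : ℝ × ℝ → ℂ := fun p => conj (dx Φ p) * dx Ψ p + 1 / 2 * (conj (dy Φ p) * dy Ψ p)
    + 1 / 2 * (p.2 : ℂ) ^ 2 * (conj (Φ p) * Ψ p) with hQ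
  have iA : Integrable A := (integrable_conj_mul f1.memLp px.memLp_dx).add
    (integrable_conj_mul f1.memLp_dx p1.memLp_dx)
  have iB : Integrable B := (integrable_conj_mul f1.memLp pd.memLp_dy).add
    (integrable_conj_mul f1.memLp_dy p1.memLp_dy)
  have iQ : Integrable Q := by
    refine (((integrable_conj_mul f1.memLp_dx p1.memLp_dx).add
      ((integrable_conj_mul f1.memLp_dy p1.memLp_dy).const_mul (1 / 2))).add
      ((integrable_conj_mul fy py).const_mul (1 / 2))).congr (ae_of_all _ fun p => ?_)
    simp only [Pi.add_apply, hQ, map_mul, Complex.conj_ofReal]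
    ring
  have eK : (fun p => conj (Φ p) * hamExpr Ψ p) = fun p => (Q p - A p) - 1 / 2 * B p := by
    ext p; simp only [hA, hB, hQ, hamExpr]; ring
  have iP := integrable_conj_mul ((f1.sobPair_dx o1).memLp_tr o1) ((px.sobPair_dx o1).memLp_tr o1)
  have iM := integrable_conj_mul ((f1.sobPair_dx o2).memLp_tr o2) ((px.sobPair_dx o2).memLp_tr o2)
  have eG : (fun y => greenDensity (fSum Φ y) (fJump Φ y) (fSum (dx Ψ) y) (fJump (dx Ψ) y)) =
      fun y => conj (tr 1 Φ y) * tr 1 (dx Ψ) y - conj (tr (-1) Φ y) * tr (-1) (dx Ψ) y := by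
    ext y
    rw [fSum, fJump, fSum, fJump, greenDensity_eq]
    simp only [trP_eq_tr, trM_eq_tr]
  have gA : ∫ p, A p = -((∫ y, conj (tr 1 Φ y) * tr 1 (dx Ψ) y) -
      ∫ y, conj (tr (-1) Φ y) * tr (-1) (dx Ψ) y) := by
    rw [integral_eq_add_halfPlanes iA, (f1.sobPair_dx o1).green_x o1 (px.sobPair_dx o1),
      (f1.sobPair_dx o2).green_x o2 (px.sobPair_dx o2)]
    push_cast; ring
  have gB : ∫ p, B p = 0 := by
    rw [integral_eq_add_halfPlanes iB, (f1.sobPair_dy o1).green_y (pd.sobPair_dy o1),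
      (f1.sobPair_dy o2).green_y (pd.sobPair_dy o2), add_zero]
  have iQA : Integrable fun p => Q p - A p := iQ.sub iA
  rw [eK, eG]
  refine ⟨iQA.sub (iB.const_mul _), iP.sub iM, ?_⟩
  rw [integral_sub iQA (iB.const_mul _), integral_sub iQ iA, integral_const_mul, gB, gA,
    integral_sub iP iM]
  change ∫ p, Q p = _
  ring

theorem integrable_mul_of_sqrt {X Y : ℝ → ℂ} (hX : MemLp (fun y => ((√|y| : ℝ) : ℂ) * X y) 2 volume)
    (hY : MemLp (fun y => ((√|y| : ℝ) : ℂ) * Y y) 2 volume) :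
    Integrable (fun y : ℝ => (y : ℂ) * (conj (X y) * Y y)) := by
  -- Here `y / |y|` is the sign of y, equal to 0 at y = 0; y is split as sign · √|y| · √|y|.
  have hm : Measurable fun y : ℝ => ((y / |y| : ℝ) : ℂ) := by fun_prop
  refine ((integrable_conj_mul hX hY).bdd_mul (c := 1) hm.aestronglyMeasurable
    (ae_of_all _ fun y => ?_)).congr (ae_of_all _ fun y => ?_)
  · rw [Complex.norm_real, Real.norm_eq_abs, abs_div, abs_abs]
    exact div_self_le_one _
  · have h1 : ((√|y| : ℝ) : ℂ) * ((√|y| : ℝ) : ℂ) = ((|y| : ℝ) : ℂ) := by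
      rw [← Complex.ofReal_mul, Real.mul_self_sqrt (abs_nonneg y)]
    have h2 : ((y / |y| : ℝ) : ℂ) * ((|y| : ℝ) : ℂ) = (y : ℂ) := by
      rw [← Complex.ofReal_mul]
      rcases eq_or_ne y 0 with rfl | hy
      · simp
      · rw [div_mul_cancel₀ _ (abs_ne_zero.2 hy)]
    simp only [map_mul, Complex.conj_ofReal]
    linear_combination ((y / |y| : ℝ) : ℂ) * conj (X y) * Y y * h1 + conj (X y) * Y y * h2

theorem memLp_sqrt_fSum {Ψ : ℝ × ℝ → ℂ} (h : Ψ ∈ formDom) :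
    MemLp (fun y => ((√|y| : ℝ) : ℂ) * fSum Ψ y) 2 volume ∧
    MemLp (fun y => ((√|y| : ℝ) : ℂ) * fJump Ψ y) 2 volume := by
  obtain ⟨p1, py⟩ := mem_formDom_iff.1 h
  have l1 := (p1.sobPair_dx (Or.inl rfl)).memLp_weight_tr (Or.inl rfl) (py.restrict _)
  have l2 := (p1.sobPair_dx (Or.inr rfl)).memLp_weight_tr (Or.inr rfl) (py.restrict _)
  simp only [fSum, fJump, trP_eq_tr, trM_eq_tr, mul_add, mul_sub]
  exact ⟨l1.add l2, l1.sub l2⟩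

theorem memLp_fSum {Ψ : ℝ × ℝ → ℂ} (h : MemH1Sum Ψ) :
    MemLp (fSum Ψ) 2 volume ∧ MemLp (fJump Ψ) 2 volume := by
  have l1 := (h.sobPair_dx (Or.inl rfl)).memLp_tr (Or.inl rfl)
  have l2 := (h.sobPair_dx (Or.inr rfl)).memLp_tr (Or.inr rfl)
  have e1 : fSum Ψ = tr 1 Ψ + tr (-1) Ψ := by
    ext y; simp [fSum, trP_eq_tr, trM_eq_tr]
  have e2 : fJump Ψ = tr 1 Ψ - tr (-1) Ψ := by
    ext y; simp [fJump, trP_eq_tr, trM_eq_tr]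
  rw [e1, e2]
  exact ⟨l1.add l2, l1.sub l2⟩

/-- The sesquilinear form, with its boundary terms collected in one integral. -/
theorem formS_eq (α β : ℝ) (γ : ℂ) {Φ Ψ : ℝ × ℝ → ℂ} (hΦ : Φ ∈ formDom) (hΨ : Ψ ∈ formDom) :
    Integrable (fun y => formDensity α β γ y (fSum Φ y) (fJump Φ y) (fSum Ψ y) (fJump Ψ y)) ∧
    formS α β γ Φ Ψ = a0S Φ Ψ +
      ∫ y, formDensity α β γ y (fSum Φ y) (fJump Φ y) (fSum Ψ y) (fJump Ψ y) := by
  obtain ⟨fs, fj⟩ := memLp_sqrt_fSum hΦ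
  obtain ⟨ps, pj⟩ := memLp_sqrt_fSum hΨ
  have iSS : ∀ k : ℝ, Integrable fun y : ℝ => ((k * y : ℝ) : ℂ) * (conj (fSum Φ y) * fSum Ψ y) :=
    fun k => ((integrable_mul_of_sqrt fs ps).const_mul (k : ℂ)).congr (ae_of_all _ fun y => by
      simp only; push_cast; ring)
  unfold formS formDensity
  by_cases hβ : β = 0
  · simp only [hβ, if_true]
    exact ⟨iSS _, rfl⟩
  · simp only [hβ, if_false]
    have i1 := integrable_mul_of_sqrt fj pj
    have i2 := iSS ((α * β + ‖γ‖ ^ 2) / 4)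
    have i3 : Integrable fun y : ℝ => (y : ℂ) * (1 / 2) *
        (γ * conj (fSum Φ y) * fJump Ψ y + conj γ * conj (fJump Φ y) * fSum Ψ y) := by
      refine (((integrable_mul_of_sqrt fs pj).const_mul (γ / 2)).add
        ((integrable_mul_of_sqrt fj ps).const_mul (conj γ / 2))).congr (ae_of_all _ fun y => ?_)
      simp only [Pi.add_apply]; ring
    have i12 : Integrable fun y : ℝ => (y : ℂ) * (conj (fJump Φ y) * fJump Ψ y) +
        (((α * β + ‖γ‖ ^ 2) / 4 * y : ℝ) : ℂ) * (conj (fSum Φ y) * fSum Ψ y) := i1.add i2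
    refine ⟨(i12.add i3).const_mul _, ?_⟩
    rw [integral_const_mul, integral_add i12 i3, integral_add i1 i2]
    rfl

/-- The defect between the form and the operator is a boundary integral. -/
theorem formS_eq_integral_add (α β : ℝ) (γ : ℂ) {Φ Ψ : ℝ × ℝ → ℂ} (hΦ : Φ ∈ formDom)
    (hΨ : Ψ ∈ formDom) (h2 : MemH2Sum Ψ) :
    formS α β γ Φ Ψ = (∫ p, conj (Φ p) * hamExpr Ψ p) +
      ∫ y, (formDensity α β γ y (fSum Φ y) (fJump Φ y) (fSum Ψ y) (fJump Ψ y) -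
        greenDensity (fSum Φ y) (fJump Φ y) (fSum (dx Ψ) y) (fJump (dx Ψ) y)) := by
  obtain ⟨-, i1, e1⟩ := green_formula hΦ hΨ h2
  obtain ⟨i2, e2⟩ := formS_eq α β γ hΦ hΨ
  rw [integral_sub i2 i1, e2, e1]
  ring

/-- The coupling conditions make the boundary terms of the form and of Green's formula agree. -/
theorem formDensity_eq_greenDensity {α β : ℝ} {γ : ℂ} {y : ℝ} (hy : y ≠ 0) {S J s j s' j' : ℂ}
    (hSJ : β = 0 → J = -(conj γ / 2) * S)
    (h1 : j' = (α / 2 : ℂ) * y * s + γ / 2 * s')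
    (h2 : j = -(conj γ / 2) * s + (β / (2 * y) : ℂ) * s') :
    formDensity α β γ y S J s j = greenDensity S J s' j' := by
  have hyC : (y : ℂ) ≠ 0 := Complex.ofReal_ne_zero.2 hy
  have hn : ((‖γ‖ ^ 2 : ℝ) : ℂ) = γ * conj γ := by
    rw [Complex.mul_conj, Complex.normSq_eq_norm_sq]
  unfold formDensity greenDensity
  split_ifs with hβ
  -- The essential condition on the test function makes the terms with `s'` cancel.
  · have hJ : conj J = -(γ / 2) * conj S := by
      rw [hSJ hβ, map_mul, map_neg, map_div₀, Complex.conj_conj, Complex.conj_ofNat]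
    rw [hJ, h1]; push_cast; ring
  · have hβC : (β : ℂ) ≠ 0 := Complex.ofReal_ne_zero.2 hβ
    -- For β ≠ 0 the second condition determines `s'`, and the identity then holds for arbitrary `S`
    -- and `J`.
    have hs' : s' = 2 * y / β * (j + conj γ / 2 * s) := by
      rw [h2]; field_simp; ring
    have hc : (((α * β + ‖γ‖ ^ 2) / 4 * y : ℝ) : ℂ) = (α * β + γ * conj γ) / 4 * y := by
      rw [← hn]; push_cast; ring
    rw [h1, hs', hc]
    field_simp
    ring

/-- The pairs (2, 0) and (0, 2) are the sums and jumps of the traces (1, 1) and (1, −1); they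
isolate `j'` and `s'` in the Green density. -/
theorem coupling_of_densities_eq {α β : ℝ} {γ : ℂ} {y : ℝ} (hy : y ≠ 0) (hβ : β ≠ 0)
    {s j s' j' : ℂ} (h1 : formDensity α β γ y 2 0 s j = greenDensity 2 0 s' j')
    (h2 : formDensity α β γ y 0 2 s j = greenDensity 0 2 s' j') :
    j' = (α / 2 : ℂ) * y * s + γ / 2 * s' ∧
      j = -(conj γ / 2) * s + (β / (2 * y) : ℂ) * s' := by
  have hyC : (y : ℂ) ≠ 0 := Complex.ofReal_ne_zero.2 hy
  have hβC : (β : ℂ) ≠ 0 := Complex.ofReal_ne_zero.2 hβ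
  have hn : ((‖γ‖ ^ 2 : ℝ) : ℂ) = γ * conj γ := by
    rw [Complex.mul_conj, Complex.normSq_eq_norm_sq]
  have hc : (((α * β + ‖γ‖ ^ 2) / 4 * y : ℝ) : ℂ) = (α * β + γ * conj γ) / 4 * y := by
    rw [← hn]; push_cast; ring
  have t : conj (2 : ℂ) = 2 := Complex.conj_ofNat 2
  simp only [formDensity, greenDensity, if_neg hβ, hc, t, map_zero] at h1 h2
  have e1 : j' = 1 / β * ((α * β + γ * conj γ) / 2 * y * s + y * γ * j) := by
    linear_combination -h1
  have e2 : s' = 1 / β * (2 * y * j + y * conj γ * s) := by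
    linear_combination -h2
  constructor
  · rw [e1, e2]; field_simp; ring
  · rw [e2]; field_simp; ring

/-- The pair (2, −conj γ) spans the solutions of the essential condition. Only the first coupling
condition has to be recovered, since the second is built into `essDom`. -/
theorem coupling_of_density_eq {α : ℝ} {γ : ℂ} {y : ℝ} {s j s' j' : ℂ}
    (h : formDensity α 0 γ y 2 (-conj γ) s j = greenDensity 2 (-conj γ) s' j') :
    j' = (α / 2 : ℂ) * y * s + γ / 2 * s' := by
  have t : conj (2 : ℂ) = 2 := Complex.conj_ofNat 2
  simp only [formDensity, greenDensity, if_true, t, map_neg, Complex.conj_conj] at h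
  push_cast at h
  linear_combination -h

/-- Solving the differential expression for y²Ψ shows that it is in L², and |y| ≤ 1 + y² then bounds
yΨ. -/
theorem mem_formDom_of_memLp_hamExpr {Ψ : ℝ × ℝ → ℂ} (h2 : MemH2Sum Ψ)
    (hH : MemLp (hamExpr Ψ) 2 volume) : Ψ ∈ formDom := by
  obtain ⟨p1, px, pd⟩ := h2
  refine mem_formDom_iff.2 ⟨p1, ?_⟩
  have hyy : MemLp (fun p => (p.2 : ℂ) ^ 2 * Ψ p) 2 volume := by
    have := ((hH.const_mul 2).add (px.memLp_dx.const_mul 2)).add pd.memLp_dy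
    refine (memLp_congr_ae (ae_of_all _ fun p => ?_)).1 this
    simp only [Pi.add_apply, hamExpr]; ring
  have hc : Continuous fun p : ℝ × ℝ => (p.2 : ℂ) := by fun_prop
  refine (p1.memLp.norm.add hyy.norm).of_le (hc.aestronglyMeasurable.mul p1.memLp.1)
    (ae_of_all _ fun p => ?_)
  rw [Pi.add_apply, Real.norm_of_nonneg (by positivity), norm_mul, norm_mul, norm_pow,
    Complex.norm_real, Real.norm_eq_abs]
  nlinarith [norm_nonneg (Ψ p), sq_nonneg (|p.2| - 1), abs_nonneg p.2,
    mul_nonneg (norm_nonneg (Ψ p)) (sq_nonneg (|p.2| - 1)),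
    mul_nonneg (norm_nonneg (Ψ p)) (abs_nonneg p.2)]

theorem coupling2_zero_iff (γ : ℂ) (Ψ : ℝ × ℝ → ℂ) :
    Coupling2 0 γ Ψ ↔ ∀ᵐ y : ℝ, fJump Ψ y = -(conj γ / 2) * fSum Ψ y := by
  simp [Coupling2]

/-- The operator represents the form. -/
theorem formS_eq_integral_hamExpr {α β : ℝ} {γ : ℂ} {Φ Ψ : ℝ × ℝ → ℂ} (hΦ : Φ ∈ essDom β γ)
    (hΨ : Ψ ∈ domH α β γ) : formS α β γ Φ Ψ = ∫ p, conj (Φ p) * hamExpr Ψ p := by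
  obtain ⟨h2, hH, c1, c2⟩ := hΨ
  rw [formS_eq_integral_add α β γ hΦ.1 (mem_formDom_of_memLp_hamExpr h2 hH) h2, add_eq_left]
  refine integral_eq_zero_of_ae ?_
  have hz : ∀ᵐ y : ℝ, β = 0 → fJump Φ y = -(conj γ / 2) * fSum Φ y := by
    by_cases hβ : β = 0
    · exact ((coupling2_zero_iff γ Φ).1 (hΦ.2 hβ)).mono fun y hy _ => hy
    · exact ae_of_all _ fun y h => absurd h hβ
  filter_upwards [c1, c2, hz, Measure.ae_ne volume (0 : ℝ)] with y e1 e2 e3 hy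
  exact sub_eq_zero.2 (formDensity_eq_greenDensity hy e3 e1 e2)

theorem mem_essDom_of_mem_domH {α β : ℝ} {γ : ℂ} {Ψ : ℝ × ℝ → ℂ} (hΨ : Ψ ∈ domH α β γ) :
    Ψ ∈ essDom β γ :=
  ⟨mem_formDom_of_memLp_hamExpr hΨ.1 hΨ.2.1, fun h => h ▸ hΨ.2.2.2⟩

/-! ### Test functions with prescribed traces -/

/-- The function equal to `c φ` on the right and to `d φ` on the left of the line `x = 0`. -/
def glue (c d : ℂ) (φ : ℝ × ℝ → ℝ) (p : ℝ × ℝ) : ℂ := if 0 < p.1 then c * φ p else d * φ p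

theorem isWeakDeriv_smooth (U : Set (ℝ × ℝ)) (v : ℝ × ℝ) (c : ℂ)
    {φ : ℝ × ℝ → ℝ} (hφ : ContDiff ℝ ∞ φ) :
    IsWeakDeriv U v (fun p => c * φ p) (fun p => c * (fderiv ℝ φ p v : ℝ)) := by
  have hd : Differentiable ℝ φ := hφ.differentiable (by simp)
  have hcd : Continuous fun p => fderiv ℝ φ p v :=
    (hφ.continuous_fderiv (by simp)).clm_apply continuous_const
  have c1 : Continuous fun p => c * (φ p : ℂ) := by have := hφ.continuous; fun_prop
  have c2 : Continuous fun p => c * (fderiv ℝ φ p v : ℂ) := by fun_prop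
  refine ⟨c1.locallyIntegrable.locallyIntegrableOn _, c2.locallyIntegrable.locallyIntegrableOn _,
    fun χ h1 h2 h3 => ?_⟩
  have hχ : Differentiable ℝ χ := h1.differentiable (by simp)
  have hcχ : Continuous fun p => fderiv ℝ χ p v :=
    (h1.continuous_fderiv (by simp)).clm_apply continuous_const
  have s1 : ∀ p ∉ U, χ p = 0 := fun p hp => image_eq_zero_of_notMem_tsupport fun hm => hp (h3 hm)
  have s2 : ∀ p ∉ U, fderiv ℝ χ p v = 0 := fun p hp => by
    have : p ∉ tsupport (fderiv ℝ χ) := fun hm => hp (h3 (tsupport_fderiv_subset ℝ hm))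
    rw [image_eq_zero_of_notMem_tsupport this]; rfl
  have ibp := integral_mul_fderiv_eq_neg_fderiv_mul_of_integrable (μ := volume) (f := φ) (g := χ)
    (v := v) ((hcd.mul h1.continuous).integrable_of_hasCompactSupport h2.mul_left)
    ((hφ.continuous.mul hcχ).integrable_of_hasCompactSupport (h2.fderiv_apply ℝ v).mul_left)
    ((hφ.continuous.mul h1.continuous).integrable_of_hasCompactSupport h2.mul_left)
    (fun p _ => hd p) (fun p _ => hχ p)
  rw [setIntegral_eq_integral_of_forall_compl_eq_zero fun p hp => by rw [s2 p hp, zero_smul],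
    setIntegral_eq_integral_of_forall_compl_eq_zero fun p hp => by rw [s1 p hp, zero_smul]]
  have e1 : ∀ p, (fderiv ℝ χ p v) • (c * (φ p : ℂ)) = c * ((φ p * fderiv ℝ χ p v : ℝ) : ℂ) := by
    intro p; rw [Complex.real_smul]; push_cast; ring
  have e2 : ∀ p, χ p • (c * (fderiv ℝ φ p v : ℂ)) = c * ((fderiv ℝ φ p v * χ p : ℝ) : ℂ) := by
    intro p; rw [Complex.real_smul]; push_cast; ring
  simp only [e1, e2]
  rw [integral_const_mul, integral_const_mul, integral_complex_ofReal, integral_complex_ofReal,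
    ibp]
  push_cast; ring

theorem memLp_smooth {c : ℂ} {φ : ℝ × ℝ → ℝ} (hφ : Continuous φ) (hc : HasCompactSupport φ) :
    MemLp (fun p => c * (φ p : ℂ)) 2 volume := by
  have h : MemLp φ 2 volume := hφ.memLp_of_hasCompactSupport hc
  exact h.ofReal.const_mul c

theorem memH1_of_eqOn_smooth {U : Set (ℝ × ℝ)} (hU : IsOpen U) {c : ℂ} {φ : ℝ × ℝ → ℝ}
    (hφ : ContDiff ℝ ∞ φ) (hc : HasCompactSupport φ) {f : ℝ × ℝ → ℂ}
    (e : Set.EqOn (fun p => c * (φ p : ℂ)) f U) : MemH1 U f := by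
  have hw : ∀ v, ∃ g, IsWeakDeriv U v f g ∧ MemLp g 2 (volume.restrict U) := fun v =>
    ⟨_, (isWeakDeriv_smooth U v c hφ).congr hU e fun _ _ => rfl,
      (memLp_smooth ((hφ.continuous_fderiv (by simp)).clm_apply continuous_const)
        (hc.fderiv_apply ℝ v)).restrict _⟩
  refine ⟨(memLp_congr_ae ?_).1 ((memLp_smooth (c := c) hφ.continuous hc).restrict U), hw ex, hw ey⟩
  filter_upwards [ae_restrict_mem hU.measurableSet] with p hp using e hp

theorem glue_memH1Sum (c d : ℂ) {φ : ℝ × ℝ → ℝ} (hφ : ContDiff ℝ ∞ φ)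
    (hc : HasCompactSupport φ) : MemH1Sum (glue c d φ) := by
  constructor
  · refine memH1_of_eqOn_smooth (by rw [← halfPlane_one]; exact isOpen_halfPlane 1) (c := c) hφ hc
      fun p hp => ?_
    have hp' : 0 < p.1 := hp
    simp [glue, hp']
  · refine memH1_of_eqOn_smooth (by rw [← halfPlane_neg_one]; exact isOpen_halfPlane (-1))
      (c := d) hφ hc fun p hp => ?_
    have hp' : ¬ 0 < p.1 := not_lt.2 (le_of_lt hp)
    simp [glue, hp']

theorem glue_mem_formDom (c d : ℂ) {φ : ℝ × ℝ → ℝ} (hφ : ContDiff ℝ ∞ φ)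
    (hc : HasCompactSupport φ) : glue c d φ ∈ formDom := by
  refine mem_formDom_iff.2 ⟨glue_memH1Sum c d hφ hc, ?_⟩
  have h2 : ContDiff ℝ ∞ fun p : ℝ × ℝ => p.2 * φ p := contDiff_snd.mul hφ
  refine (memLp_congr_ae (ae_of_all _ fun p => ?_)).1 (glue_memH1Sum c d h2 hc.mul_left).memLp
  simp only [glue]
  split_ifs <;> push_cast <;> ring

theorem tr_glue (c d : ℂ) {φ : ℝ × ℝ → ℝ} (hφ : Continuous φ) (y : ℝ) :
    tr 1 (glue c d φ) y = c * φ (0, y) ∧ tr (-1) (glue c d φ) y = d * φ (0, y) := by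
  have hpos : ∀ᶠ x in zeroPlus, (0 : ℝ) < x := by
    have : ∀ᶠ x in 𝓝[>] (0 : ℝ), 0 < x := eventually_mem_nhdsWithin
    exact this.filter_mono inf_le_right
  have lim : ∀ (σ : ℝ) (e : ℂ),
      Tendsto (fun x : ℝ => e * (φ (σ * x, y) : ℂ)) zeroPlus (𝓝 (e * φ (0, y))) := by
    intro σ e
    have hcont : Continuous fun x : ℝ => e * (φ (σ * x, y) : ℂ) := by fun_prop
    have := hcont.tendsto 0
    rw [mul_zero] at this
    exact this.mono_left (inf_le_right.trans nhdsWithin_le_nhds)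
  constructor
  · refine Tendsto.limUnder_eq ((lim 1 c).congr' ?_)
    filter_upwards [hpos] with x hx
    simp [glue, hx]
  · refine Tendsto.limUnder_eq ((lim (-1) d).congr' ?_)
    filter_upwards [hpos] with x hx
    simp [glue, hx.le]

theorem fSum_glue (c d : ℂ) {φ : ℝ × ℝ → ℝ} (hφ : Continuous φ) (y : ℝ) :
    fSum (glue c d φ) y = (φ (0, y) : ℂ) * (c + d) ∧
      fJump (glue c d φ) y = (φ (0, y) : ℂ) * (c - d) := by
  obtain ⟨h1, h2⟩ := tr_glue c d hφ y
  rw [fSum, fJump, trP_eq_tr, trM_eq_tr, h1, h2]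
  constructor <;> ring

/-- The densities are antilinear in the test traces, so a real factor such as φ(0, y) can be pulled
out. -/
theorem formDensity_real_mul (α β : ℝ) (γ : ℂ) (y r : ℝ) (S J s j : ℂ) :
    formDensity α β γ y (r * S) (r * J) s j = r * formDensity α β γ y S J s j := by
  unfold formDensity
  split_ifs <;> simp only [map_mul, Complex.conj_ofReal] <;> ring

theorem greenDensity_real_mul (r : ℝ) (S J s j : ℂ) :
    greenDensity (r * S) (r * J) s j = r * greenDensity S J s j := by
  unfold greenDensity
  simp only [map_mul, Complex.conj_ofReal]; ring

theorem glue_mem_essDom {β : ℝ} {γ c d : ℂ} (h : β = 0 → c - d = -(conj γ / 2) * (c + d))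
    {φ : ℝ × ℝ → ℝ} (hφ : ContDiff ℝ ∞ φ) (hc : HasCompactSupport φ) :
    glue c d φ ∈ essDom β γ := by
  refine ⟨glue_mem_formDom c d hφ hc, fun hβ => ?_⟩
  rw [coupling2_zero_iff]
  refine ae_of_all _ fun y => ?_
  obtain ⟨h1, h2⟩ := fSum_glue c d hφ.continuous y
  rw [h1, h2, h hβ]; ring

/-! ### Recovering the operator from the form -/

theorem locallyIntegrable_hamExpr {Ψ : ℝ × ℝ → ℂ} (h2 : MemH2Sum Ψ) :
    LocallyIntegrable (hamExpr Ψ) volume := by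
  obtain ⟨p1, px, pd⟩ := h2
  have l : ∀ {f : ℝ × ℝ → ℂ}, MemLp f 2 volume → LocallyIntegrable f volume := fun hf =>
    hf.locallyIntegrable (by norm_num)
  have hc : Continuous fun p : ℝ × ℝ => (p.2 : ℂ) ^ 2 := by fun_prop
  exact (l px.memLp_dx).neg.add (((l pd.memLp_dy).neg.add ((l p1.memLp).continuous_mul hc)).continuous_mul
    continuous_const)

/-- Test functions supported off x = 0 have zero traces, so they are admissible for every β and
leave no boundary term. Hence `w` and `hamExpr Ψ` agree off the line, which is a null set. -/
theorem ae_eq_hamExpr {α β : ℝ} {γ : ℂ} {Ψ w : ℝ × ℝ → ℂ} (h2 : MemH2Sum Ψ)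
    (hw : MemLp w 2 volume) (hΨ : Ψ ∈ formDom)
    (h : ∀ Φ ∈ essDom β γ, formS α β γ Φ Ψ = ∫ p, conj (Φ p) * w p) :
    w =ᵐ[volume] hamExpr Ψ := by
  set U := halfPlane 1 ∪ halfPlane (-1)
  have hU : IsOpen U := (isOpen_halfPlane _).union (isOpen_halfPlane _)
  have lw : LocallyIntegrable w volume := hw.locallyIntegrable (by norm_num)
  have lh := locallyIntegrable_hamExpr h2
  have key := hU.ae_eq_zero_of_integral_contDiff_smul_eq_zero (μ := volume)
    (f := fun p => w p - hamExpr Ψ p) ((lw.sub lh).locallyIntegrableOn U) (by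
      intro φ h1 hc hs
      have h0 : ∀ y, φ (0, y) = 0 := fun y => image_eq_zero_of_notMem_tsupport fun hm => by
        rcases hs hm with h' | h' <;> simp [halfPlane] at h'
      have hmem : glue 1 1 φ ∈ formDom := glue_mem_formDom 1 1 h1 hc
      have hess : glue 1 1 φ ∈ essDom β γ := by
        refine ⟨hmem, fun _ => (coupling2_zero_iff _ _).2 (ae_of_all _ fun y => ?_)⟩
        obtain ⟨g1, g2⟩ := fSum_glue 1 1 h1.continuous y
        simp [g1, g2, h0]
      have e := h _ hess
      rw [formS_eq_integral_add α β γ hmem hΨ h2] at e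
      have ez : ∀ y, formDensity α β γ y (fSum (glue 1 1 φ) y) (fJump (glue 1 1 φ) y) (fSum Ψ y)
          (fJump Ψ y) - greenDensity (fSum (glue 1 1 φ) y) (fJump (glue 1 1 φ) y)
          (fSum (dx Ψ) y) (fJump (dx Ψ) y) = 0 := fun y => by
        obtain ⟨g1, g2⟩ := fSum_glue 1 1 h1.continuous y
        rw [g1, g2, formDensity_real_mul, greenDensity_real_mul, h0]
        simp
      simp only [ez, integral_zero, add_zero] at e
      have eg : ∀ (k : ℝ × ℝ → ℂ) p, conj (glue 1 1 φ p) * k p = φ p • k p := fun k p => by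
        simp [glue]
      simp only [eg] at e
      simp only [smul_sub]
      rw [integral_sub (lw.integrable_smul_left_of_hasCompactSupport h1.continuous hc)
        (lh.integrable_smul_left_of_hasCompactSupport h1.continuous hc), ← e, sub_self])
  rw [← restrict_halfPlanes]
  rw [Filter.EventuallyEq, ae_restrict_iff' hU.measurableSet]
  filter_upwards [key] with p hp hpU using sub_eq_zero.1 (hp hpU)

/-- With constant test traces the factor y is unbounded and no global integrability is available;
local integrability is enough for the fundamental lemma on the line. -/
theorem locallyIntegrable_formDensity (α β : ℝ) (γ S J : ℂ) {s j : ℝ → ℂ}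
    (hs : MemLp s 2 volume) (hj : MemLp j 2 volume) :
    LocallyIntegrable (fun y => formDensity α β γ y S J (s y) (j y)) volume := by
  have ls : LocallyIntegrable s volume := hs.locallyIntegrable (by norm_num)
  have lj : LocallyIntegrable j volume := hj.locallyIntegrable (by norm_num)
  have m : ∀ (k : ℂ) {f : ℝ → ℂ}, LocallyIntegrable f volume →
      LocallyIntegrable (fun y : ℝ => k * (y : ℂ) * f y) volume := fun k f hf =>
    hf.continuous_mul (by fun_prop)
  by_cases hβ : β = 0
  · refine (m (α / 4 * conj S) ls).congr (ae_of_all _ fun y => ?_)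
    simp only [formDensity, if_pos hβ]; push_cast; ring
  · refine ((m (1 / β * (conj J + γ * conj S / 2)) lj).add
      (m (1 / β * ((α * β + ‖γ‖ ^ 2) / 4 * conj S + conj γ * conj J / 2)) ls)).congr
      (ae_of_all _ fun y => ?_)
    simp only [formDensity, if_neg hβ, Pi.add_apply]; push_cast; ring

theorem locallyIntegrable_greenDensity (S J : ℂ) {s j : ℝ → ℂ}
    (hs : MemLp s 2 volume) (hj : MemLp j 2 volume) :
    LocallyIntegrable (fun y => greenDensity S J (s y) (j y)) volume := by
  have ls : LocallyIntegrable s volume := hs.locallyIntegrable (by norm_num)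
  have lj : LocallyIntegrable j volume := hj.locallyIntegrable (by norm_num)
  exact ((lj.continuous_mul continuous_const).add (ls.continuous_mul continuous_const)).continuous_mul
    continuous_const

/-- Testing with a function of traces c ψ and d ψ turns the boundary integral into ∫ ψ · (difference
of densities). As ψ is arbitrary, the difference vanishes almost everywhere. -/
theorem ae_densities_eq {α β : ℝ} {γ : ℂ} {Ψ : ℝ × ℝ → ℂ} (h2 : MemH2Sum Ψ) (hΨ : Ψ ∈ formDom)
    (h : ∀ Φ ∈ essDom β γ, formS α β γ Φ Ψ = ∫ p, conj (Φ p) * hamExpr Ψ p) {c d : ℂ}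
    (hcd : β = 0 → c - d = -(conj γ / 2) * (c + d)) :
    ∀ᵐ y : ℝ, formDensity α β γ y (c + d) (c - d) (fSum Ψ y) (fJump Ψ y) =
      greenDensity (c + d) (c - d) (fSum (dx Ψ) y) (fJump (dx Ψ) y) := by
  obtain ⟨m1, m2⟩ := memLp_fSum hΨ.1
  obtain ⟨m3, m4⟩ := memLp_fSum h2.2.1
  have key := ae_eq_zero_of_integral_contDiff_smul_eq_zero (μ := (volume : Measure ℝ))
    ((locallyIntegrable_formDensity α β γ (c + d) (c - d) m1 m2).sub
      (locallyIntegrable_greenDensity (c + d) (c - d) m3 m4)) (by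
      intro ψ h1 hc
      -- The cutoff equals 1 near x = 0, so the traces of η(x) ψ(y) are exactly ψ.
      let η : ContDiffBump (0 : ℝ) := ⟨1, 2, one_pos, one_lt_two⟩
      set φ : ℝ × ℝ → ℝ := fun p => η p.1 * ψ p.2 with hφ
      have sφ : ContDiff ℝ ∞ φ := (η.contDiff.comp contDiff_fst).mul (h1.comp contDiff_snd)
      have cφ : HasCompactSupport φ := by
        refine HasCompactSupport.intro (η.hasCompactSupport.isCompact.prod hc.isCompact)
          fun p hp => ?_
        by_cases h' : p.1 ∈ tsupport η
        · have : p.2 ∉ tsupport ψ := fun h'' => hp ⟨h', h''⟩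
          simp [hφ, image_eq_zero_of_notMem_tsupport this]
        · simp [hφ, image_eq_zero_of_notMem_tsupport h']
      have h0 : ∀ y, φ (0, y) = ψ y := fun y => by
        simp only [hφ]
        rw [η.one_of_mem_closedBall (by simp [η]), one_mul]
      have hess := glue_mem_essDom hcd sφ cφ
      have e := h _ hess
      rw [formS_eq_integral_add α β γ hess.1 hΨ h2, add_eq_left] at e
      rw [← e]
      congr 1; ext y
      obtain ⟨g1, g2⟩ := fSum_glue c d sφ.continuous y
      rw [g1, g2, formDensity_real_mul, greenDensity_real_mul, h0, ← mul_sub, Complex.real_smul]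
      rfl)
  filter_upwards [key] with y hy using sub_eq_zero.1 hy

theorem mem_domH_of_form {α β : ℝ} {γ : ℂ} {Ψ w : ℝ × ℝ → ℂ} (h2 : MemH2Sum Ψ)
    (hw : MemLp w 2 volume) (hΨ : Ψ ∈ essDom β γ)
    (h : ∀ Φ ∈ essDom β γ, formS α β γ Φ Ψ = ∫ p, conj (Φ p) * w p) :
    Ψ ∈ domH α β γ ∧ w =ᵐ[volume] hamExpr Ψ := by
  have hae := ae_eq_hamExpr h2 hw hΨ.1 h
  have h' : ∀ Φ ∈ essDom β γ, formS α β γ Φ Ψ = ∫ p, conj (Φ p) * hamExpr Ψ p := fun Φ hΦ => by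
    rw [h Φ hΦ]
    exact integral_congr_ae (hae.mono fun p hp => by simp only [hp])
  refine ⟨⟨h2, (memLp_congr_ae hae).1 hw, ?_⟩, hae⟩
  by_cases hβ : β = 0
  · subst hβ
    refine ⟨?_, hΨ.2 rfl⟩
    -- These traces have sum 2 and jump −conj γ, as the essential condition requires.
    have := ae_densities_eq h2 hΨ.1 h' (c := 1 - conj γ / 2) (d := 1 + conj γ / 2)
      (fun _ => by ring)
    rw [show (1 - conj γ / 2) + (1 + conj γ / 2) = (2 : ℂ) by ring,
      show (1 - conj γ / 2) - (1 + conj γ / 2) = -conj γ by ring] at this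
    exact this.mono fun y hy => coupling_of_density_eq hy
  · have e1 := ae_densities_eq h2 hΨ.1 h' (c := 1) (d := 1) (fun h => absurd h hβ)
    have e2 := ae_densities_eq h2 hΨ.1 h' (c := 1) (d := -1) (fun h => absurd h hβ)
    rw [show (1 : ℂ) + 1 = 2 by norm_num, sub_self] at e1
    rw [add_neg_cancel, show (1 : ℂ) - -1 = 2 by norm_num] at e2
    have := e1.and (e2.and (Measure.ae_ne volume (0 : ℝ)))
    exact ⟨this.mono fun y hy => (coupling_of_densities_eq hy.2.2 hβ hy.1 hy.2.1).1,
      this.mono fun y hy => (coupling_of_densities_eq hy.2.2 hβ hy.1 hy.2.1).2⟩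

/-! ### Traces and boundary integrals on the form domain -/

theorem ae_tendsto_traces {Ψ : ℝ × ℝ → ℂ} (h : MemH1Sum Ψ) :
    ∀ᵐ y : ℝ, Tendsto (fun x => Ψ (x, y)) zeroPlus (𝓝 (trP Ψ y)) ∧
      Tendsto (fun x => Ψ (x, y)) zeroMinus (𝓝 (trM Ψ y)) := by
  filter_upwards [(h.sobPair_dx (Or.inl rfl)).ae_hasPrim_tr (Or.inl rfl),
    (h.sobPair_dx (Or.inr rfl)).ae_hasPrim_tr (Or.inr rfl)] with y h1 h2
  rw [trP_eq_tr, trM_eq_tr]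
  refine ⟨by simpa using h1.2, ?_⟩
  rw [zeroMinus_eq_map, tendsto_map'_iff]
  simpa [Function.comp_def] using h2.2

theorem integrable_boundary_densities (α β : ℝ) (γ : ℂ) {Ψ : ℝ × ℝ → ℂ} (h : Ψ ∈ formDom) :
    Integrable (b1Density Ψ) ∧ Integrable (b2Density α β γ Ψ) ∧
      Integrable (b3Density γ Ψ) ∧ Integrable (b4Density α Ψ) := by
  obtain ⟨ps, pj⟩ := memLp_sqrt_fSum h
  have hz : ∀ (r : ℝ) (z : ℂ), ((r : ℂ) * (conj z * z)).re = r * ‖z‖ ^ 2 := fun r z => by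
    rw [mul_comm (conj z), Complex.mul_conj, Complex.normSq_eq_norm_sq, ← Complex.ofReal_mul,
      Complex.ofReal_re]
  have iS : Integrable fun y => y * ‖fSum Ψ y‖ ^ 2 :=
    (integrable_mul_of_sqrt ps ps).re.congr (ae_of_all _ fun y => hz y _)
  have iJ : Integrable fun y => y * ‖fJump Ψ y‖ ^ 2 :=
    (integrable_mul_of_sqrt pj pj).re.congr (ae_of_all _ fun y => hz y _)
  refine ⟨iJ, (iS.const_mul ((α * β + ‖γ‖ ^ 2) / 4)).congr (ae_of_all _ fun y => ?_), ?_,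
    (iS.const_mul (α / 4)).congr (ae_of_all _ fun y => ?_)⟩
  · simp only [b2Density]; ring
  · refine ((integrable_mul_of_sqrt ps pj).const_mul γ).re.congr (ae_of_all _ fun y => ?_)
    rw [b3Density, ← Complex.re_ofReal_mul]
    change (γ * ((y : ℂ) * (conj (fSum Ψ y) * fJump Ψ y))).re = _
    congr 1; ring
  · simp only [b4Density]; ring

end Smilansky

end

theorem mainTheorem8 (α β : ℝ) (γ : ℂ) :
    -- on `D` the traces exist and all boundary integrals converge absolutely
    (∀ Ψ ∈ Smilansky.formDom,
      (∀ᵐ y : ℝ, Tendsto (fun x => Ψ (x, y)) Smilansky.zeroPlus (𝓝 (Smilansky.trP Ψ y)) ∧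
        Tendsto (fun x => Ψ (x, y)) Smilansky.zeroMinus (𝓝 (Smilansky.trM Ψ y))) ∧
      Integrable (Smilansky.b1Density Ψ) ∧ Integrable (Smilansky.b2Density α β γ Ψ) ∧
      Integrable (Smilansky.b3Density γ Ψ) ∧ Integrable (Smilansky.b4Density α Ψ)) ∧
    -- the quadratic form of the operator: `(Ψ, H Ψ) = a[Ψ]` on `dom H ⊆ D`
    (∀ Ψ ∈ Smilansky.domH α β γ, Ψ ∈ Smilansky.formDom ∧
      Integrable (fun p => conj (Ψ p) * Smilansky.hamExpr Ψ p) ∧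
      ∫ p, conj (Ψ p) * Smilansky.hamExpr Ψ p = (Smilansky.form α β γ Ψ : ℂ)) ∧
    -- the operator is recovered from the form
    (∀ Ψ w : ℝ × ℝ → ℂ, Smilansky.MemH2Sum Ψ → MemLp w 2 →
      ((Ψ ∈ Smilansky.domH α β γ ∧ w =ᵐ[volume] Smilansky.hamExpr Ψ) ↔
        (Ψ ∈ Smilansky.essDom β γ ∧ ∀ Φ ∈ Smilansky.essDom β γ,
          Smilansky.formS α β γ Φ Ψ = ∫ p, conj (Φ p) * w p))) := by
  refine ⟨fun Ψ hΨ => ⟨Smilansky.ae_tendsto_traces hΨ.1,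
    Smilansky.integrable_boundary_densities α β γ hΨ⟩, fun Ψ hΨ => ?_, fun Ψ w h2 hw => ⟨?_, ?_⟩⟩
  · have hess := Smilansky.mem_essDom_of_mem_domH hΨ
    refine ⟨hess.1, (Smilansky.green_formula hess.1 hess.1 hΨ.1).1, ?_⟩
    -- Since the domain lies in `essDom`, Ψ itself is an admissible test function; Φ = Ψ gives the
    -- quadratic form.
    rw [← Smilansky.formS_self, Smilansky.formS_eq_integral_hamExpr hess hΨ]
  · rintro ⟨hΨ, hae⟩
    refine ⟨Smilansky.mem_essDom_of_mem_domH hΨ, fun Φ hΦ => ?_⟩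
    rw [Smilansky.formS_eq_integral_hamExpr hΦ hΨ]
    exact integral_congr_ae (hae.mono fun p hp => by simp only [hp])
  · rintro ⟨hess, h⟩
    exact Smilansky.mem_domH_of_form h2 hw hess h
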